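/- Let $H$ be a nonabelian group that is a semidirect product $\mathbb{Z}_7 \ltimes (\mathbb{Z}_2)^3$, where the normal factor is $(\mathbb{Z}_2)^3$. Let $p > 5$ be a prime, and let $G$ be any semidirect product $H \ltimes \mathbb{Z}_p$, where the normal factor is $\mathbb{Z}_p$. Then every connected Cayley graph on $G$ has a hamiltonian cycle. That is, for every subset $S$ of $G$, let $\mathrm{Cay}(G;S)$ be the simple graph with vertex set $G$ in which two distinct vertices $g$ and $h$ are adjacent if and only if $h = gs$ for some $s \in S \cup S^{-1}$; if $\mathrm{Cay}(G;S)$ is connected, then it contains a cycle that passes through every vertex exactly once. -/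

import Mathlib

/-! Let `q : G → H` be the projection, with kernel `ℤ_p`, and let `c` be the `ℤ_p`-coordinate. It is
a crossed homomorphism for the character `χ` through which `H` acts on `ℤ_p`, and `χ` kills `(ℤ₂)³`.
A word tracing a hamiltonian cycle in a Cayley graph of `H` has its product in the kernel. If that
product is nontrivial, repeating the word `p` times traces a hamiltonian cycle of `G`
(`exists_isHamiltonianCycle_of_quotient`). The task is thus to find words on which `c` does not
vanish.

Choose generators `a` with nontrivial `ℤ₇`-part and `b` with `q b` outside the powers of `q a`. The
group `(ℤ₂)³` is the field of order 8, on which `a` or `a⁻¹` acts as a root of `X³ + X + 1`. After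
inverting `a` or `b` if necessary, the pair is determined in `H` up to isomorphism by the exponent
`j < 4` with `b ≡ a ^ j` modulo `(ℤ₂)³` (`exists_isCoding`). Hence a few explicit words, verified by
computation, serve all `p`.

If `χ` is nontrivial or `p = 7`, a second crossed homomorphism (`χ - 1`, or the `ℤ₇`-coordinate when
`χ = 1`) detects the `ℤ₇`-part. Subtracting a multiple of it makes `c a = 0`, and then `cycleWord`
has value `2 * c b`. Otherwise `c` is a homomorphism, and two words whose exponent sums have
determinant ±14 or ±28 cannot both have value zero unless `c a = c b = 0`.

If `c` vanishes at both `a` and `b`, some generator `d` has `c d ≠ 0`. When `d` lies in the kernel,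
the cosets of the kernel are traversed one at a time in alternating directions. Otherwise `d`
replaces `a` or `b`, or closes up a hamiltonian path. -/

/-! ### Hamiltonian cycles of Cayley graphs from enumerations -/

/-- A cyclic enumeration of the vertices along edges gives a hamiltonian cycle. -/
theorem exists_isHamiltonianCycle_of_enumeration {V : Type*} [Fintype V] [DecidableEq V]
    (Γ : SimpleGraph V) (n : ℕ) (hn : 3 ≤ n) (hV : Fintype.card V = n) (f : ℕ → V)
    (hinj : ∀ i < n, ∀ k < n, f i = f k → i = k)
    (hadj : ∀ i < n, Γ.Adj (f i) (f (i + 1))) (hclose : f n = f 0) :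
    ∃ (g : V) (C : Γ.Walk g g), C.IsHamiltonianCycle := by
  obtain ⟨m, rfl⟩ : ∃ m, n = m + 3 := ⟨n - 3, by omega⟩
  have key : ∀ u v : Fin (m + 3), u - v = 1 → Γ.Adj (f u) (f v) := by
    intro u v huv
    have hu : u = v + 1 := by rw [← huv]; abel
    subst hu
    have h := (hadj v v.2).symm
    -- At the last vertex, `v + 1` wraps around to `0`, and `hclose` supplies the edge.
    rcases Fin.eq_castSucc_or_eq_last v with ⟨w, rfl⟩ | rfl
    · simpa using h
    · simpa [hclose] using h
  let F : SimpleGraph.cycleGraph (m + 3) →g Γ :=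
    ⟨fun i => f i, fun {u v} huv => by
      rcases SimpleGraph.cycleGraph_adj.1 huv with h | h
      · exact key u v h
      · exact (key v u h).symm⟩
  have hF : Function.Injective F := fun u v huv =>
    Fin.ext (hinj u u.2 v v.2 huv)
  refine ⟨F 0, (SimpleGraph.cycleGraph.cycle m).map F, ?_⟩
  rw [SimpleGraph.Walk.isHamiltonianCycle_iff_isCycle_and_length_eq]
  exact ⟨SimpleGraph.cycleGraph.isCycle_cycle.map hF, by
    rw [SimpleGraph.Walk.length_map, SimpleGraph.cycleGraph.length_cycle, hV]⟩

/-- A set whose Cayley graph is connected generates the group. -/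
theorem closure_eq_top_of_mulCayley_connected {G : Type*} [Group G] {S : Set G}
    (hS : (SimpleGraph.mulCayley S).Connected) : Subgroup.closure S = ⊤ := by
  rw [eq_top_iff]
  intro g _
  obtain ⟨w⟩ := hS.preconnected g 1
  have key : ∀ u v : G, (SimpleGraph.mulCayley S).Walk u v →
      (u ∈ Subgroup.closure S ↔ v ∈ Subgroup.closure S) := by
    intro u v w
    induction w with
    | nil => rfl
    | cons h _ ih =>
      obtain ⟨-, s, hs, rfl | rfl⟩ := (SimpleGraph.mulCayley_adj' S _ _).1 h
      · rw [← ih, Subgroup.mul_mem_cancel_right _ (Subgroup.subset_closure hs)]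
      · rw [← ih, Subgroup.mul_mem_cancel_right _ (Subgroup.subset_closure hs)]
  exact (key _ _ w).2 (one_mem _)

theorem orderOf_eq_of_mem_of_prime_card {G : Type*} [Group G] {N : Subgroup G} {p : ℕ}
    (hp : p.Prime) (hN : Nat.card N = p) {x : G} (hx : x ∈ N) (hx1 : x ≠ 1) : orderOf x = p := by
  have h1 := hN ▸ orderOf_dvd_natCard (⟨x, hx⟩ : N)
  rw [Subgroup.orderOf_mk] at h1
  exact ((Nat.dvd_prime hp).1 h1).resolve_left (by simpa using hx1)

section Cayley

variable {G K : Type*} [Group G] [Group K] [Fintype G] [DecidableEq G] {S : Set G}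

theorem exists_isHamiltonianCycle_mulCayley_of_enumeration
    (n : ℕ) (hn : 3 ≤ n) (hG : Fintype.card G = n) (f : ℕ → G)
    (hinj : ∀ i < n, ∀ k < n, f i = f k → i = k)
    (hstep : ∀ i < n, ∃ s ∈ S, f (i + 1) = f i * s) (hclose : f n = f 0) :
    ∃ (g : G) (C : (SimpleGraph.mulCayley S).Walk g g), C.IsHamiltonianCycle := by
  refine exists_isHamiltonianCycle_of_enumeration _ n hn hG f hinj (fun i hi => ?_) hclose
  obtain ⟨s, hs, h⟩ := hstep i hi
  rw [SimpleGraph.mulCayley_adj']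
  refine ⟨fun he => ?_, s, hs, .inl h.symm⟩
  -- `S` may contain `1`, so that consecutive vertices differ has to come from injectivity.
  rcases Nat.lt_or_ge (i + 1) n with h1 | h1
  · have := hinj i hi (i + 1) h1 he
    omega
  · have h2 : i + 1 = n := by omega
    rw [h2, hclose] at he
    have := hinj i hi 0 (by omega) he
    omega

/-- The factor group lemma: a cyclic enumeration of a quotient by a subgroup of prime order lifts to
a hamiltonian cycle as soon as it does not close up in the group. -/
theorem exists_isHamiltonianCycle_of_quotient (q : G →* K) {p n : ℕ}
    (hp : p.Prime) (hn : 3 ≤ n) (hG : Fintype.card G = n * p) (hker : Nat.card q.ker = p)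
    (f : ℕ → G) (h0 : f 0 = 1)
    (hinj : ∀ i < n, ∀ k < n, q (f i) = q (f k) → i = k)
    (hstep : ∀ i < n, ∃ s ∈ S, f (i + 1) = f i * s) (hclose : q (f n) = 1) (hne : f n ≠ 1) :
    ∃ (g : G) (C : (SimpleGraph.mulCayley S).Walk g g), C.IsHamiltonianCycle := by
  have hord : orderOf (f n) = p :=
     orderOf_eq_of_mem_of_prime_card (N := q.ker) hp hker hclose hne
  have hn0 : 0 < n := by omega
  have hp1 := hp.pos
  -- Go around the quotient cycle `p` times; each turn multiplies on the left by `f n`, a generator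
  -- of the kernel.
  refine exists_isHamiltonianCycle_mulCayley_of_enumeration (n * p) (by nlinarith) hG
    (fun k => f n ^ (k / n) * f (k % n)) ?_ ?_ ?_
  · intro i hi k hk h
    have hmod : i % n = k % n := by
      apply hinj _ (Nat.mod_lt _ hn0) _ (Nat.mod_lt _ hn0)
      simpa [hclose] using congrArg q h
    have hdiv : f n ^ (i / n) = f n ^ (k / n) := by
      simpa [hmod] using h
    have hd := pow_injOn_Iio_orderOf (x := f n)
      (by simpa [hord] using Nat.div_lt_of_lt_mul hi)
      (by simpa [hord] using Nat.div_lt_of_lt_mul hk) hdiv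
    rw [← Nat.div_add_mod i n, ← Nat.div_add_mod k n, hmod, hd]
  · intro i _
    obtain ⟨s, hs, h⟩ := hstep (i % n) (Nat.mod_lt _ hn0)
    refine ⟨s, hs, ?_⟩
    rw [mul_assoc, ← h]
    rcases Nat.lt_or_ge (i % n + 1) n with h1 | h1
    · have hi : i + 1 = i / n * n + (i % n + 1) := by
        have := Nat.div_add_mod' i n; omega
      rw [hi, Nat.add_comm, Nat.add_mul_div_right _ _ hn0, Nat.add_mul_mod_self_right,
        Nat.div_eq_of_lt h1, Nat.mod_eq_of_lt h1, Nat.zero_add]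
    · have h2 : i % n + 1 = n := by have := Nat.mod_lt i hn0; omega
      have hi : i + 1 = (i / n + 1) * n := by
        have := Nat.div_add_mod' i n; rw [Nat.add_mul]; omega
      rw [hi, Nat.mul_div_cancel _ hn0, Nat.mul_mod_left, h0, h2, mul_one, pow_succ]
  · simp [hn0, h0, ← hord, pow_orderOf_eq_one]

/-- A hamiltonian cycle that runs through the cosets of a kernel of prime order one at a time. -/
theorem exists_isHamiltonianCycle_of_rows (hS : ∀ s ∈ S, s⁻¹ ∈ S) (q : G →* K) {p n : ℕ}
    (hp : p.Prime) (hn : 3 ≤ n) (hG : Fintype.card G = n * p) (hker : Nat.card q.ker = p)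
    {d : G} (hd : d ∈ S) (hqd : q d = 1) (hd1 : d ≠ 1)
    (f : ℕ → G) (ε : ℕ → ℤ) (hε : ∀ i, ε i = 1 ∨ ε i = -1) (h0 : f 0 = 1)
    (hinj : ∀ i < n, ∀ k < n, q (f i) = q (f k) → i = k)
    (hstep : ∀ i < n, ∃ s ∈ S, f (i + 1) = f i * d ^ (-ε i) * s) (hclose : f n = 1) :
    ∃ (g : G) (C : (SimpleGraph.mulCayley S).Walk g g), C.IsHamiltonianCycle := by
  have hord : orderOf d = p :=
    orderOf_eq_of_mem_of_prime_card (N := q.ker) hp hker hqd hd1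
  have hp0 := hp.pos
  have hdp : d ^ p = 1 := hord ▸ pow_orderOf_eq_one d
  -- Row `i` is the coset of `f i`, run through by `p - 1` steps `d ^ ε i`. It ends at `f i * d ^
  -- (-ε i)`, because `d ^ p = 1`.
  refine exists_isHamiltonianCycle_mulCayley_of_enumeration (n * p) (by nlinarith) hG
    (fun k => f (k / p) * (d ^ ε (k / p)) ^ (k % p)) ?_ ?_ ?_
  · intro i hi k hk h
    have hdiv : i / p = k / p := by
      apply hinj _ (Nat.div_lt_of_lt_mul (by rwa [mul_comm])) _
        (Nat.div_lt_of_lt_mul (by rwa [mul_comm]))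
      simpa [hqd] using congrArg q h
    have hpow : (d ^ ε (k / p)) ^ (i % p) = (d ^ ε (k / p)) ^ (k % p) := by
      simpa [hdiv] using h
    have hpow' : d ^ (i % p) = d ^ (k % p) := by
      rcases hε (k / p) with h1 | h1 <;> simpa [h1] using hpow
    have hm := pow_injOn_Iio_orderOf (x := d)
      (by simpa [hord] using Nat.mod_lt i hp0) (by simpa [hord] using Nat.mod_lt k hp0) hpow'
    rw [← Nat.div_add_mod i p, ← Nat.div_add_mod k p, hm, hdiv]
  · intro i hi
    have hin : i / p < n := Nat.div_lt_of_lt_mul (by rwa [mul_comm])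
    rcases Nat.lt_or_ge (i % p + 1) p with h1 | h1
    · have hi : i + 1 = i / p * p + (i % p + 1) := by
        have := Nat.div_add_mod' i p; omega
      refine ⟨d ^ ε (i / p), ?_, ?_⟩
      · rcases hε (i / p) with h2 | h2 <;> simp [h2, hd, hS d hd]
      rw [hi, Nat.add_comm, Nat.add_mul_div_right _ _ hp0, Nat.add_mul_mod_self_right,
        Nat.div_eq_of_lt h1, Nat.mod_eq_of_lt h1, Nat.zero_add, pow_succ, mul_assoc]
    · have h2 : i % p + 1 = p := by have := Nat.mod_lt i hp0; omega
      have hi : i + 1 = (i / p + 1) * p := by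
        have := Nat.div_add_mod' i p; rw [Nat.add_mul]; omega
      obtain ⟨s, hs, h⟩ := hstep _ hin
      refine ⟨s, hs, ?_⟩
      rw [hi, Nat.mul_div_cancel _ hp0, Nat.mul_mod_left, h, pow_zero, mul_one]
      congr 2
      have h3 : (d ^ ε (i / p)) ^ (i % p) * d ^ ε (i / p) = 1 := by
        rw [← pow_succ, h2, ← zpow_natCast, zpow_comm, zpow_natCast, hdp, one_zpow]
      rw [zpow_neg]
      exact (eq_inv_of_mul_eq_one_left h3).symm
  · simp [hp0, h0, hclose]

end Cayley

/-! ### Words and states for the group of order 56 -/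

/-- Letters of words in two generators; capitals stand for inverses. -/
inductive Letter
  | a | A | b | B

/-- The value of a letter at a pair of group elements. -/
def Letter.eval {G : Type*} [Group G] (x y : G) : Letter → G
  | .a => x
  | .A => x⁻¹
  | .b => y
  | .B => y⁻¹

theorem Letter.eval_mem {G : Type*} [Group G] {S : Set G} (hS : ∀ s ∈ S, s⁻¹ ∈ S) {x y : G}
    (hx : x ∈ S) (hy : y ∈ S) : ∀ l : Letter, l.eval x y ∈ S
  | .a => hx
  | .A => hS x hx
  | .b => hy
  | .B => hS y hy

theorem Letter.map_eval {G K : Type*} [Group G] [Group K] (q : G →* K) (x y : G) :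
    ∀ l : Letter, q (l.eval x y) = l.eval (q x) (q y)
  | .a => rfl
  | .A => map_inv q x
  | .b => rfl
  | .B => map_inv q y

/-- The powers of a root of `X³ + X + 1` over the field with two elements, as bit vectors. -/
def rootPow : ℕ → ℕ
  | 0 => 1
  | 1 => 2
  | 2 => 4
  | 3 => 3
  | 4 => 6
  | 5 => 7
  | _ => 5

/-- Right multiplication by a letter in the group of order `56`. The state `(w, e)` stands for the
vector with bits `w` times the `e`-th power of the first generator; the second generator is the
vector `1` times the `j`-th power of the first. -/
def wordStep (j : ℕ) (s : ℕ × ℕ) : Letter → ℕ × ℕ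
  | .a => (s.1, (s.2 + 1) % 7)
  | .A => (s.1, (s.2 + 6) % 7)
  | .b => (s.1 ^^^ rootPow s.2, (s.2 + j) % 7)
  | .B => (s.1 ^^^ rootPow ((s.2 + (7 - j)) % 7), (s.2 + (7 - j)) % 7)

/-- The state reached by a word. -/
def runWord (j : ℕ) (s : ℕ × ℕ) (w : List Letter) : ℕ × ℕ := w.foldl (wordStep j) s

/-- The prefixes of the word reach `56` distinct states. -/
def IsPathWord (j : ℕ) (w : List Letter) : Prop :=
  ((List.range 56).map fun k => runWord j (0, 0) (w.take k)).Nodup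

instance (j : ℕ) (w : List Letter) : Decidable (IsPathWord j w) := by
  unfold IsPathWord; infer_instance

/-- A word whose prefixes trace a hamiltonian cycle. -/
def IsCycleWord (j : ℕ) (w : List Letter) : Prop :=
  IsPathWord j w ∧ w.length = 56 ∧ runWord j (0, 0) w = (0, 0)

instance (j : ℕ) (w : List Letter) : Decidable (IsCycleWord j w) := by
  unfold IsCycleWord; infer_instance

theorem rootPow_lt (e : ℕ) : rootPow e < 8 := by
  unfold rootPow; split <;> norm_num

theorem wordStep_lt (j : ℕ) {s : ℕ × ℕ} (hs : s.1 < 8) (l : Letter) :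
    (wordStep j s l).1 < 8 ∧ (wordStep j s l).2 < 7 := by
  have hx := fun e => Nat.xor_lt_two_pow (n := 3) hs (rootPow_lt e)
  have hm := fun n => Nat.mod_lt n (show 7 > 0 by norm_num)
  cases l
  exacts [⟨hs, hm _⟩, ⟨hs, hm _⟩, ⟨hx _, hm _⟩, ⟨hx _, hm _⟩]

theorem runWord_lt (j : ℕ) (w : List Letter) {s : ℕ × ℕ} (hs : s.1 < 8) (hs' : s.2 < 7) :
    (runWord j s w).1 < 8 ∧ (runWord j s w).2 < 7 := by
  induction w generalizing s with
  | nil => exact ⟨hs, hs'⟩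
  | cons l w ih => exact ih (wordStep_lt j hs l).1 (wordStep_lt j hs l).2

/-! ### Codings, and lifting words to hamiltonian cycles -/

/-- States are faithfully realised by group elements, compatibly with right multiplication. -/
structure IsCoding {K : Type*} [Group K] (j : ℕ) (x y : K) (nf : ℕ × ℕ → K) : Prop where
  zero : nf (0, 0) = 1
  inj : ∀ s t : ℕ × ℕ, s.1 < 8 → s.2 < 7 → t.1 < 8 → t.2 < 7 → nf s = nf t → s = t
  step : ∀ (s : ℕ × ℕ) (l : Letter), s.1 < 8 → s.2 < 7 → nf (wordStep j s l) = nf s * l.eval x y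

/-- A function satisfying the cocycle rule for a multiplicative character. -/
def IsCrossedHom {G R : Type*} [Group G] [CommRing R] (χ : G →* R) (c : G → R) : Prop :=
  ∀ g h, c (g * h) = c g + χ g * c h

section Coding

variable {G K : Type*} [Group G] [Group K] {q : G →* K} {j : ℕ} {x y : G} {nf : ℕ × ℕ → K}

theorem IsCoding.run (h : IsCoding j (q x) (q y) nf) (w : List Letter) {s : ℕ × ℕ}
    (hs : s.1 < 8) (hs' : s.2 < 7) :
    nf (runWord j s w) = nf s * q (w.map (Letter.eval x y)).prod := by
  induction w generalizing s with
  | nil => simp [runWord]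
  | cons l w ih =>
    have h1 := wordStep_lt j hs l
    have h2 := ih h1.1 h1.2
    rw [h.step s l hs hs'] at h2
    simpa [runWord, mul_assoc, Letter.map_eval] using h2

theorem IsCoding.run_zero (h : IsCoding j (q x) (q y) nf) (w : List Letter) :
    nf (runWord j (0, 0) w) = q (w.map (Letter.eval x y)).prod := by
  rw [h.run w (by norm_num) (by norm_num), h.zero, one_mul]

theorem IsPathWord.injOn {w : List Letter} (hw : IsPathWord j w) {i k : ℕ} (hi : i < 56)
    (hk : k < 56) (h : runWord j (0, 0) (w.take i) = runWord j (0, 0) (w.take k)) : i = k :=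
  List.inj_on_of_nodup_map hw (List.mem_range.2 hi) (List.mem_range.2 hk) h

variable [Fintype G] [DecidableEq G] {S : Set G} {p : ℕ}

/-- `M` is empty when `w` is itself a closed word, and consists of one further generator when `w` is
a hamiltonian path to be closed. -/
theorem IsCoding.exists_isHamiltonianCycle (h : IsCoding j (q x) (q y) nf)
    (hS : ∀ s ∈ S, s⁻¹ ∈ S) (hx : x ∈ S) (hy : y ∈ S) (hp : p.Prime)
    (hG : Fintype.card G = 56 * p) (hker : Nat.card q.ker = p) {w : List Letter}
    (hw : IsPathWord j w) (hlen : 55 ≤ w.length) {M : List G} (hM : ∀ s ∈ M, s ∈ S)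
    (hlen' : w.length + M.length = 56)
    (hq : q ((w.map (Letter.eval x y)).prod * M.prod) = 1)
    (hne : (w.map (Letter.eval x y)).prod * M.prod ≠ 1) :
    ∃ (g : G) (C : (SimpleGraph.mulCayley S).Walk g g), C.IsHamiltonianCycle := by
  set L := w.map (Letter.eval x y) ++ M with hL
  have hLlen : L.length = 56 := by simpa [hL] using hlen'
  have hfull : (L.take 56).prod = (w.map (Letter.eval x y)).prod * M.prod := by
    rw [List.take_of_length_le hLlen.le, hL, List.prod_append]
  have htake : ∀ k < 56, q (L.take k).prod = nf (runWord j (0, 0) (w.take k)) := by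
    intro k hk
    rw [h.run_zero, hL, List.take_append_of_le_length (by simp; omega), List.map_take]
  refine exists_isHamiltonianCycle_of_quotient q hp (n := 56) (by norm_num) hG hker
    (fun k => (L.take k).prod) (by simp) ?_ ?_ (by rw [hfull, hq]) (by rwa [hfull])
  · intro i hi k hk hik
    rw [htake i hi, htake k hk] at hik
    have hi' := runWord_lt j (w.take i) (s := (0, 0)) (by norm_num) (by norm_num)
    have hk' := runWord_lt j (w.take k) (s := (0, 0)) (by norm_num) (by norm_num)
    exact hw.injOn hi hk (h.inj _ _ hi'.1 hi'.2 hk'.1 hk'.2 hik)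
  · intro i hi
    have hmem : ∀ s ∈ L, s ∈ S := by
      intro s hs
      rw [hL, List.mem_append, List.mem_map] at hs
      rcases hs with ⟨l, -, rfl⟩ | hs
      · exact Letter.eval_mem hS hx hy l
      · exact hM _ hs
    exact ⟨L[i], hmem _ (List.getElem_mem _), List.prod_take_succ _ _ _⟩

theorem IsCoding.exists_isHamiltonianCycle_of_cycleWord (h : IsCoding j (q x) (q y) nf)
    (hS : ∀ s ∈ S, s⁻¹ ∈ S) (hx : x ∈ S) (hy : y ∈ S) (hp : p.Prime)
    (hG : Fintype.card G = 56 * p) (hker : Nat.card q.ker = p) {w : List Letter}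
    (hw : IsCycleWord j w) (hne : (w.map (Letter.eval x y)).prod ≠ 1) :
    ∃ (g : G) (C : (SimpleGraph.mulCayley S).Walk g g), C.IsHamiltonianCycle :=
  h.exists_isHamiltonianCycle hS hx hy hp hG hker hw.1 (hw.2.1 ▸ by norm_num) (M := [])
    (by simp) (by simp [hw.2.1])
    (by rw [List.prod_nil, mul_one, ← h.run_zero, hw.2.2, h.zero]) (by simpa using hne)

end Coding

/-! ### Values of crossed homomorphisms at words -/

/-- Coefficient of the `i`-th power of the character value in the contribution of the first
generator to the value of a crossed homomorphism at a word. -/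
def coeffA (j i : ℕ) : ℕ → List Letter → ℤ
  | _, [] => 0
  | e, .a :: w => (if e = i then 1 else 0) + coeffA j i ((e + 1) % 7) w
  | e, .A :: w => (if (e + 6) % 7 = i then -1 else 0) + coeffA j i ((e + 6) % 7) w
  | e, .b :: w => coeffA j i ((e + j) % 7) w
  | e, .B :: w => coeffA j i ((e + (7 - j)) % 7) w

/-- Coefficient of the `i`-th power of the character value in the contribution of the second
generator to the value of a crossed homomorphism at a word. -/
def coeffB (j i : ℕ) : ℕ → List Letter → ℤ
  | _, [] => 0
  | e, .a :: w => coeffB j i ((e + 1) % 7) w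
  | e, .A :: w => coeffB j i ((e + 6) % 7) w
  | e, .b :: w => (if e = i then 1 else 0) + coeffB j i ((e + j) % 7) w
  | e, .B :: w => (if (e + (7 - j)) % 7 = i then -1 else 0) + coeffB j i ((e + (7 - j)) % 7) w

section CrossedHom

variable {G R : Type*} [Group G] [CommRing R] {χ : G →* R} {c : G → R}

theorem IsCrossedHom.map_one (hc : IsCrossedHom χ c) : c 1 = 0 := by
  have := hc 1 1
  simpa using this

theorem IsCrossedHom.map_inv (hc : IsCrossedHom χ c) (g : G) : χ g * c g⁻¹ = -c g := by
  have := hc g g⁻¹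
  rw [mul_inv_cancel, hc.map_one] at this
  linear_combination -this

theorem IsCrossedHom.map_inv_eq_zero (hc : IsCrossedHom χ c) {g : G} (hg : c g = 0) :
    c g⁻¹ = 0 := by
  have h := hc g⁻¹ g
  rw [inv_mul_cancel, hc.map_one, hg, mul_zero, add_zero] at h
  exact h.symm

theorem IsCrossedHom.eq_zero_iff (hc : IsCrossedHom χ c) {g g' : G} (hg : g' = g ∨ g' = g⁻¹) :
    c g' = 0 ↔ c g = 0 := by
  rcases hg with rfl | rfl
  · rfl
  · exact ⟨fun h => by simpa using hc.map_inv_eq_zero h, hc.map_inv_eq_zero⟩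

theorem isCrossedHom_char_sub_one : IsCrossedHom χ fun g => χ g - 1 := fun g g' => by
  dsimp only
  rw [map_mul]
  ring

theorem pow_mod_of_pow_seven {τ : R} (hτ : τ ^ 7 = 1) (n : ℕ) : τ ^ (n % 7) = τ ^ n := by
  conv_rhs => rw [← Nat.div_add_mod n 7, pow_add, pow_mul, hτ, one_pow, one_mul]

theorem sum_pow_mul_ite (τ : R) {e : ℕ} (he : e < 7) (n : ℤ) (r : R) :
    ∑ i ∈ Finset.range 7, τ ^ i * (((if e = i then n else 0 : ℤ) : R) * r) = τ ^ e * n * r := by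
  rw [Finset.sum_eq_single_of_mem e (Finset.mem_range.2 he)]
  · simp [mul_assoc]
  · intro i _ hi
    simp [Ne.symm hi]

theorem map_inv_of_pow_seven {x y : G} {j : ℕ} (hx : χ x ^ 7 = 1) (hy : χ y = χ x ^ j)
    (hj : j < 7) : χ y⁻¹ = χ x ^ (7 - j) := by
  have h1 : χ y⁻¹ * χ y = 1 := by rw [← map_mul]; simp
  have h2 : χ y * χ x ^ (7 - j) = 1 := by
    rw [hy, ← pow_add, Nat.add_sub_cancel' hj.le, hx]
  linear_combination (-χ y⁻¹) * h2 + χ x ^ (7 - j) * h1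

/-- By the cocycle rule each letter contributes its own value scaled by the character of the prefix
before it, a power of `χ x`; an inverse letter contributes negatively, at the exponent after it. The
factor `χ x ^ e` allows induction from an arbitrary starting exponent. -/
theorem IsCrossedHom.word (hc : IsCrossedHom χ c) {x y : G} {j : ℕ} (hj : j < 7)
    (hx : χ x ^ 7 = 1) (hy : χ y = χ x ^ j) (w : List Letter) {e : ℕ} (he : e < 7) :
    χ x ^ e * c (w.map (Letter.eval x y)).prod = ∑ i ∈ Finset.range 7,
      χ x ^ i * ((coeffA j i e w : R) * c x + (coeffB j i e w : R) * c y) := by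
  have hm := fun n => Nat.mod_lt n (show 7 > 0 by norm_num)
  have hinvx : χ x⁻¹ = χ x ^ 6 := map_inv_of_pow_seven hx (pow_one _).symm (by norm_num)
  have hinvy : χ y⁻¹ = χ x ^ (7 - j) := map_inv_of_pow_seven hx hy hj
  have hcx : c x⁻¹ = -(χ x ^ 6 * c x) := by
    linear_combination χ x ^ 6 * hc.map_inv x - c x⁻¹ * hx
  have hcy : c y⁻¹ = -(χ x ^ (7 - j) * c y) := by
    have h2 : χ y * χ x ^ (7 - j) = 1 := by
      rw [hy, ← pow_add, Nat.add_sub_cancel' hj.le, hx]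
    linear_combination χ x ^ (7 - j) * hc.map_inv y - c y⁻¹ * h2
  induction w generalizing e with
  | nil => simp [hc.map_one, coeffA, coeffB]
  | cons l w ih =>
    rw [List.map_cons, List.prod_cons, hc]
    cases l
    · have h1 := ih (hm (e + 1))
      have h2 := sum_pow_mul_ite (χ x) he 1 (c x)
      simp only [coeffA, coeffB, Letter.eval, Int.cast_add, add_mul, mul_add,
        Finset.sum_add_distrib] at h1 h2 ⊢
      rw [pow_mod_of_pow_seven hx, pow_succ] at h1
      push_cast at h2 ⊢
      linear_combination h1 - h2
    · have h1 := ih (hm (e + 6))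
      have h2 := sum_pow_mul_ite (χ x) (hm (e + 6)) (-1) (c x)
      simp only [coeffA, coeffB, Letter.eval, Int.cast_add, add_mul, mul_add,
        Finset.sum_add_distrib] at h1 h2 ⊢
      rw [pow_mod_of_pow_seven hx, pow_add] at h1 h2
      rw [hcx, hinvx]
      push_cast at h2 ⊢
      linear_combination h1 - h2
    · have h1 := ih (hm (e + j))
      have h2 := sum_pow_mul_ite (χ x) he 1 (c y)
      simp only [coeffA, coeffB, Letter.eval, Int.cast_add, add_mul, mul_add,
        Finset.sum_add_distrib] at h1 h2 ⊢
      rw [pow_mod_of_pow_seven hx, pow_add] at h1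
      rw [hy]
      push_cast at h2 ⊢
      linear_combination h1 - h2
    · have h1 := ih (hm (e + (7 - j)))
      have h2 := sum_pow_mul_ite (χ x) (hm (e + (7 - j))) (-1) (c y)
      simp only [coeffA, coeffB, Letter.eval, Int.cast_add, add_mul, mul_add,
        Finset.sum_add_distrib] at h1 h2 ⊢
      rw [pow_mod_of_pow_seven hx, pow_add] at h1 h2
      rw [hcy, hinvy]
      push_cast at h2 ⊢
      linear_combination h1 - h2

end CrossedHom

/-! ### Explicit words and their verification -/

open Letter in
/-- Hamiltonian cycles at which a crossed homomorphism vanishing at the first generator takes twice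
its value at the second generator. -/
def cycleWord : ℕ → List Letter
  | 0 => [b, a, B, a, B, A, b, A, B, A, b, A, B, a, a, b, A, A, b, A, b, A, A, A, b, a, a, B,
      a, B, A, A, b, a, a, B, A, b, A, A, B, a, a, a, b, a, b, a, a, b, A, A, B, a, B, a]
  | 1 => [b, a, a, b, b, a, b, b, a, B, a, a, b, b, b, b, b, A, B, A, B, B, A, b, a, b, a, b,
      a, B, B, B, B, A, A, A, A, B, A, B, A, A, A, b, A, A, B, A, B, B, B, a, a, b, a, b]
  | 2 => [b, A, B, B, a, B, a, b, b, a, B, a, B, a, b, b, A, A, B, A, b, A, b, a, a, a, b, A,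
      A, B, B, B, A, A, A, A, A, A, b, A, A, B, a, b, b, b, A, A, b, A, B, a, a, a, a, a]
  | _ => [b, b, b, a, B, B, a, b, A, B, a, b, a, b, b, b, a, B, A, B, A, b, b, a, b, b, b, b,
      A, B, A, b, b, b, b, A, B, a, B, B, a, a, B, a, B, B, a, B, B, a, a, a, B, A, B, a]

open Letter in
/-- Further hamiltonian cycles, whose exponent sums are independent of those of `cycleWord`. -/
def altCycleWord : ℕ → List Letter
  | 0 => [A, A, B, A, b, a, b, A, B, A, b, a, B, a, a, a, B, A, b, a, a, a, a, B, a, a, a, B,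
      a, a, b, a, a, B, A, b, A, A, B, a, a, b, a, B, a, a, b, a, B, a, a, b, a, b, A, A]
  | 1 => [A, A, A, A, A, A, B, B, B, A, A, B, a, b, a, b, b, b, b, A, B, B, B, a, B, A, b, A,
      B, A, A, B, A, A, A, B, a, B, B, a, b, a, a, a, B, a, b, a, b, A, A, B, a, a, B, B]
  | 2 => [A, A, A, A, A, A, b, a, a, B, A, b, a, a, a, a, a, b, a, b, A, b, a, a, a, B, a, a,
      b, b, a, a, B, a, a, a, B, A, A, A, B, a, b, A, A, b, A, b, A, B, B, B, A, A, A, b]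
  | _ => [A, A, A, A, B, a, B, A, A, B, a, a, a, a, a, b, a, B, a, B, A, A, A, b, a, a, b, a,
      b, b, A, B, A, b, b, a, b, a, B, a, b, A, A, A, B, A, A, B, a, a, B, a, a, b, a, B]

open Letter in
/-- For `j = 0`, hamiltonian paths from the identity to the powers of the first generator with
exponents `1`, `2` and `3`. -/
def pathWord : ℕ → List Letter
  | 1 => [b, A, B, a, a, b, a, B, A, A, b, A, b, a, b, a, a, b, A, b, a, B, A, A, A, b, A, A,
      A, B, a, a, B, A, b, A, B, a, a, b, A, A, b, a, a, b, a, b, A, A, A, B, A, b, A]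
  | 2 => [A, b, A, b, A, B, a, B, a, b, a, B, A, b, a, b, a, a, b, A, B, A, b, A, b, a, a, a,
      b, a, a, B, A, b, a, a, b, A, A, B, A, A, b, a, a, a, a, B, A, A, B, A, A, B, a]
  | _ => [b, a, b, a, a, a, b, A, B, a, b, a, a, b, A, b, a, b, A, A, b, A, A, B, A, A, b, A,
      b, A, b, a, a, B, a, a, a, B, A, A, B, a, B, a, a, B, a, b, a, a, b, a, B, a, a]

theorem isCycleWord_cycleWord : ∀ j < 4, IsCycleWord j (cycleWord j) := by
  decide +kernel

theorem isCycleWord_altCycleWord : ∀ j < 4, IsCycleWord j (altCycleWord j) := by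
  decide +kernel

theorem isPathWord_pathWord : ∀ m < 4, m ≠ 0 → IsPathWord 0 (pathWord m) ∧
    (pathWord m).length = 55 ∧ runWord 0 (0, 0) (pathWord m) = (0, m) := by
  decide +kernel

/-- The other powers of the character value cancel identically, so the value `2 * c y` (when `c x =
0`) does not depend on which seventh root of unity occurs. -/
theorem coeffB_cycleWord : ∀ j < 4, ∀ i < 7,
    coeffB j i 0 (cycleWord j) = if i = 0 then 2 else 0 := by
  decide +kernel

/-- The determinant of the exponent sums of the two cycle words. -/
theorem exponent_det : ∀ j < 4,
    |(∑ i ∈ Finset.range 7, coeffA j i 0 (cycleWord j)) *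
      (∑ i ∈ Finset.range 7, coeffB j i 0 (altCycleWord j)) -
    (∑ i ∈ Finset.range 7, coeffB j i 0 (cycleWord j)) *
      (∑ i ∈ Finset.range 7, coeffA j i 0 (altCycleWord j))| ∈ ({14, 28} : Finset ℤ) := by
  decide +kernel

/-! ### Alternating directions along the cosets of the kernel -/

/-- A sign depending on the third bit of the state. -/
def stateSign (s : ℕ × ℕ) : ℤ := if s.1 < 4 then 1 else -1

/-- The sum of the signs of the states with second component `i` that precede the letters of a
word. -/
def signSum (j i : ℕ) : ℕ × ℕ → List Letter → ℤ
  | _, [] => 0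
  | s, l :: w => (if s.2 = i then stateSign s else 0) + signSum j i (wordStep j s l) w

/-- A cycle word leaves each state exactly once, and at each exponent four of the eight vectors have
third bit `0` and four have it `1`. -/
theorem signSum_cycleWord : ∀ j < 4, ∀ i < 7, signSum j i (0, 0) (cycleWord j) = 0 := by
  decide +kernel

/-- The value of a word with a power of `d` inserted before every letter. -/
def rowProd {G : Type*} [Group G] (x y d : G) (j : ℕ) : ℕ × ℕ → List Letter → G
  | _, [] => 1
  | s, l :: w => d ^ (-stateSign s) * l.eval x y * rowProd x y d j (wordStep j s l) w

theorem rowProd_append {G : Type*} [Group G] (x y d : G) (j : ℕ) (w : List Letter) (l : Letter)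
    (s : ℕ × ℕ) : rowProd x y d j s (w ++ [l]) =
      rowProd x y d j s w * d ^ (-stateSign (runWord j s w)) * l.eval x y := by
  induction w generalizing s with
  | nil => simp [rowProd, runWord]
  | cons m w ih => simp [rowProd, ih, runWord, mul_assoc]

theorem stateSign_eq (s : ℕ × ℕ) : stateSign s = 1 ∨ stateSign s = -1 := by
  unfold stateSign; split <;> simp

section Rows

variable {G K R : Type*} [Group G] [Group K] [CommRing R] {χ : G →* R} {c : G → R} {q : G →* K}
  {j : ℕ} {x y d : G} {nf : ℕ × ℕ → K}

theorem IsCrossedHom.map_eval_eq_zero (hc : IsCrossedHom χ c) (hx : c x = 0) (hy : c y = 0) :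
    ∀ l : Letter, c (l.eval x y) = 0
  | .a => hx
  | .A => hc.map_inv_eq_zero hx
  | .b => hy
  | .B => hc.map_inv_eq_zero hy

/-- Since `c` vanishes at both generators, only the inserted powers of `d` contribute, each scaled
by `χ x ^ i` at exponent `i`. -/
theorem IsCrossedHom.rowProd (hc : IsCrossedHom χ c) (hj : j < 7)
    (hx : χ x ^ 7 = 1) (hy : χ y = χ x ^ j) (hd : χ d = 1) (hcx : c x = 0) (hcy : c y = 0)
    (w : List Letter) {s : ℕ × ℕ} (hs : s.2 < 7) :
    χ x ^ s.2 * c (rowProd x y d j s w) =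
      -∑ i ∈ Finset.range 7, χ x ^ i * ((signSum j i s w : R) * c d) := by
  induction w generalizing s with
  | nil => simp [_root_.rowProd, hc.map_one, signSum]
  | cons l w ih =>
    have hinvx : χ x⁻¹ = χ x ^ 6 := map_inv_of_pow_seven hx (pow_one _).symm (by norm_num)
    have hlt : (wordStep j s l).2 < 7 := by cases l <;> exact Nat.mod_lt _ (by norm_num)
    have hl : χ x ^ (wordStep j s l).2 = χ x ^ s.2 * χ (l.eval x y) := by
      cases l <;> simp only [wordStep, Letter.eval, pow_mod_of_pow_seven hx, pow_add, hy,
        pow_one, map_inv_of_pow_seven hx hy hj, hinvx]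
    have hcl := hc.map_eval_eq_zero hcx hcy l
    have hdinv : c d⁻¹ = -c d := by simpa [hd] using hc.map_inv d
    have hdinv' : χ d⁻¹ = 1 := by simpa [hd] using (map_mul χ d d⁻¹).symm
    have hds : c (d ^ (-stateSign s)) = -(stateSign s : R) * c d ∧ χ (d ^ (-stateSign s)) = 1 := by
      rcases stateSign_eq s with h | h <;> simp [h, hdinv, hd, hdinv']
    have h1 := ih hlt
    have h2 := sum_pow_mul_ite (χ x) hs (stateSign s) (c d)
    rw [hl] at h1
    rw [_root_.rowProd, mul_assoc, hc, hc, hds.1, hds.2, hcl]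
    simp only [signSum, Int.cast_add, add_mul, mul_add, Finset.sum_add_distrib]
    linear_combination h1 + h2

theorem map_rowProd (hd : q d = 1) (w : List Letter) (s : ℕ × ℕ) :
    q (rowProd x y d j s w) = q (w.map (Letter.eval x y)).prod := by
  induction w generalizing s with
  | nil => simp [rowProd]
  | cons l w ih => simp [rowProd, ih, hd]

variable [Fintype G] [DecidableEq G] {S : Set G} {p : ℕ}

/-- The rows are the cosets of the kernel, in the order of `cycleWord`. Directions given by the
third bit make the shifts from the row ends cancel, so the walk closes up. -/
theorem IsCoding.exists_isHamiltonianCycle_of_mem_ker (h : IsCoding j (q x) (q y) nf)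
    (hS : ∀ s ∈ S, s⁻¹ ∈ S) (hxS : x ∈ S) (hyS : y ∈ S) (hdS : d ∈ S) (hp : p.Prime)
    (hG : Fintype.card G = 56 * p) (hker : Nat.card q.ker = p) (hc : IsCrossedHom χ c)
    (hinj : ∀ g, q g = 1 → c g = 0 → g = 1) (hj : j < 4)
    (hx : χ x ^ 7 = 1) (hy : χ y = χ x ^ j) (hd : χ d = 1) (hcx : c x = 0) (hcy : c y = 0)
    (hqd : q d = 1) (hd1 : d ≠ 1) :
    ∃ (g : G) (C : (SimpleGraph.mulCayley S).Walk g g), C.IsHamiltonianCycle := by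
  have hw := isCycleWord_cycleWord j hj
  set w := cycleWord j with hwdef
  refine exists_isHamiltonianCycle_of_rows hS q hp (n := 56) (by norm_num) hG hker hdS hqd hd1
    (fun k => rowProd x y d j (0, 0) (w.take k)) (fun k => stateSign (runWord j (0, 0) (w.take k)))
    (fun k => stateSign_eq _) (by simp [rowProd]) ?_ ?_ ?_
  · intro i hi k hk hik
    rw [map_rowProd hqd, map_rowProd hqd, ← h.run_zero, ← h.run_zero] at hik
    have hi' := runWord_lt j (w.take i) (s := (0, 0)) (by norm_num) (by norm_num)
    have hk' := runWord_lt j (w.take k) (s := (0, 0)) (by norm_num) (by norm_num)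
    exact hw.1.injOn hi hk (h.inj _ _ hi'.1 hi'.2 hk'.1 hk'.2 hik)
  · intro i hi
    have hi' : i < w.length := by rw [hw.2.1]; exact hi
    refine ⟨w[i].eval x y, Letter.eval_mem hS hxS hyS _, ?_⟩
    rw [List.take_succ_eq_append_getElem hi', rowProd_append]
  · rw [List.take_of_length_le hw.2.1.le]
    apply hinj
    · rw [map_rowProd hqd, ← h.run_zero, hw.2.2, h.zero]
    · have h1 := hc.rowProd (by omega) hx hy hd hcx hcy w (s := (0, 0)) (by norm_num)
      rw [Finset.sum_eq_zero] at h1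
      · simpa using h1
      · intro i hi
        rw [signSum_cycleWord j hj i (Finset.mem_range.1 hi)]
        simp

end Rows

/-! ### Automorphisms of order 7 of the elementary abelian group of order 8 -/

section Automorphism

variable {M : Type*} [CommGroup M] {T : MulAut M}

theorem mulAut_pow_apply (T : MulAut M) (k : ℕ) (v : M) : (T ^ k) v = T^[k] v := by
  induction k with
  | zero => rfl
  | succ k ih => rw [pow_succ', MulAut.mul_apply, ih, Function.iterate_succ_apply']

theorem pow_apply_injective_of_prime {p : ℕ} (hp : p.Prime) (hT : T ^ p = 1) {v : M}
    (hv : T v ≠ v) {i k : ℕ} (hi : i < p) (hk : k < p) (h : (T ^ i) v = (T ^ k) v) : i = k := by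
  have hper : Function.minimalPeriod T v = p := by
    have h1 : Function.minimalPeriod T v ∣ p := by
      apply Function.IsPeriodicPt.minimalPeriod_dvd
      have := congrArg (fun f : MulAut M => f v) hT
      simpa [Function.IsPeriodicPt, Function.IsFixedPt, mulAut_pow_apply] using this
    refine ((Nat.dvd_prime hp).1 h1).resolve_left fun h2 => hv ?_
    exact Function.minimalPeriod_eq_one_iff_isFixedPt.1 h2
  have := Function.iterate_injOn_Iio_minimalPeriod (f := T) (x := v)
  exact this (by simpa [hper] using hi) (by simpa [hper] using hk) 
    (by simpa [mulAut_pow_apply] using h)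

/-- An automorphism of order `7` of a group of order `8` permutes the nontrivial elements
transitively. -/
theorem exists_pow_apply_eq (hM : Nat.card M = 8) (hT : T ^ 7 = 1) (hT1 : T ≠ 1) {u : M}
    (hu : u ≠ 1) : T u ≠ u ∧ ∀ v : M, v ≠ 1 → ∃ k < 7, v = (T ^ k) u := by
  classical
  have hfin : Finite M := Nat.finite_of_card_ne_zero (by omega)
  have := Fintype.ofFinite M
  have hcard : Fintype.card M = 8 := by rw [← Nat.card_eq_fintype_card, hM]
  have horb : ∀ v : M, T v ≠ v →
      ((Finset.range 7).image fun k => (T ^ k) v).card = 7 := by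
    intro v hv
    rw [Finset.card_image_of_injOn, Finset.card_range]
    intro i hi k hk h
    exact pow_apply_injective_of_prime (by norm_num) hT hv (by simpa using hi) (by simpa using hk) h
  have hone : ∀ v : M, v ≠ 1 → 1 ∉ (Finset.range 7).image fun k => (T ^ k) v := by
    intro v hv h
    obtain ⟨k, -, hk⟩ := Finset.mem_image.1 h
    exact hv ((map_eq_one_iff _ (T ^ k).injective).1 hk)
  have hcover : ∀ v : M, T v ≠ v →
      insert 1 ((Finset.range 7).image fun k => (T ^ k) v) = Finset.univ := by
    intro v hv
    have hv1 : v ≠ 1 := by rintro rfl; simp at hv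
    rw [← Finset.card_eq_iff_eq_univ, Finset.card_insert_of_notMem (hone v hv1), horb v hv, hcard]
  -- Some `v` is moved; its orbit contains every nontrivial element, so a fixed `u` would force `v`
  -- to be fixed.
  have hfix : T u ≠ u := by
    intro hTu
    obtain ⟨v, hv⟩ : ∃ v, T v ≠ v := by
      by_contra! h
      exact hT1 (MulEquiv.ext h)
    have := Finset.mem_univ u
    rw [← hcover v hv, Finset.mem_insert, Finset.mem_image] at this
    obtain ⟨k, -, hk⟩ := this.resolve_left hu
    apply hv
    apply (T ^ k).injective
    rw [← MulAut.mul_apply, ← pow_succ, pow_succ', MulAut.mul_apply, hk, hTu]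
  refine ⟨hfix, fun v hv => ?_⟩
  have := Finset.mem_univ v
  rw [← hcover u hfix, Finset.mem_insert, Finset.mem_image] at this
  obtain ⟨k, hk, hk'⟩ := this.resolve_left hv
  exact ⟨k, Finset.mem_range.1 hk, hk'.symm⟩

/-- An automorphism of order `7` of an elementary abelian group of order `8`, or its inverse,
is a root of `X³ + X + 1`. -/
theorem cube_apply_or (hM : Nat.card M = 8) (hsq : ∀ v : M, v * v = 1) (hT : T ^ 7 = 1)
    (hT1 : T ≠ 1) :
    (∀ v, (T ^ 3) v = T v * v) ∨ (∀ v, (T⁻¹ ^ 3) v = T⁻¹ v * v) := by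
  have hadd : ∀ {x y z : M}, x = y * z → y = x * z := by
    rintro x y z rfl; rw [mul_assoc, hsq, mul_one]
  have hM1 : ∃ u : M, u ≠ 1 := by
    by_contra! h
    have : Subsingleton M := ⟨fun a b => by rw [h a, h b]⟩
    rw [Nat.card_of_subsingleton (1 : M)] at hM
    omega
  obtain ⟨u, hu⟩ := hM1
  obtain ⟨hfix, htrans⟩ := exists_pow_apply_eq hM hT hT1 hu
  have hpow : ∀ i k, (T ^ (i + k)) u = (T ^ i) ((T ^ k) u) := fun i k => by
    rw [pow_add, MulAut.mul_apply]
  have hne : ∀ {i k : ℕ}, i < 7 → k < 7 → (T ^ i) u = (T ^ k) u → i = k :=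
    fun hi hk h => pow_apply_injective_of_prime (by norm_num) hT hfix hi hk h
  have hspread : ∀ f g : M →* M, (∀ k, f ((T ^ k) u) = (T ^ k) (f u)) →
      (∀ k, g ((T ^ k) u) = (T ^ k) (g u)) → f u = g u → ∀ v, f v = g v := by
    intro f g hf hg h v
    by_cases hv : v = 1
    · simp [hv]
    · obtain ⟨k, -, rfl⟩ := htrans v hv
      rw [hf, hg, h]
  have hTT : ∀ i v, T ((T ^ i) v) = (T ^ i) (T v) := fun i v => by
    rw [← MulAut.mul_apply, ← pow_succ', pow_succ, MulAut.mul_apply]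
  obtain ⟨k, hk, h⟩ := htrans (T u * u) fun h => hfix (by
    simpa using hadd (x := 1) (y := T u) (z := u) h.symm)
  have hmap : ∀ i, (T ^ (i + 1)) u * (T ^ i) u = (T ^ (i + k)) u := by
    intro i
    rw [hpow i k, ← h, map_mul, hpow i 1, pow_one]
  have h7 : ∀ i, (T ^ (i + 7)) u = (T ^ i) u := fun i => by rw [hpow, hT, MulAut.one_apply]
  have hinv : T⁻¹ = T ^ 6 := by rw [inv_eq_iff_mul_eq_one, ← pow_succ', hT]
  have hU0 : ∀ v, (T ^ 0) v = v := fun v => rfl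
  have hU1 : (T ^ 1) u = T u := rfl
  have hcube : ∀ A : MulAut M, (∀ i v, A ((T ^ i) v) = (T ^ i) (A v)) →
      (∀ i v, (A ^ 3) ((T ^ i) v) = (T ^ i) ((A ^ 3) v)) → (A ^ 3) u = A u * u →
      ∀ v, (A ^ 3) v = A v * v := fun A h1 h2 h3 =>
    hspread (A ^ 3 : MulAut M).toMonoidHom (A.toMonoidHom * MonoidHom.id M) (fun k => h2 k u)
      (fun k => by simp [h1]) (by simpa using h3)
  have hcomm : ∀ m i v, (T ^ m) ((T ^ i) v) = (T ^ i) ((T ^ m) v) := fun m i v => by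
    rw [← MulAut.mul_apply, ← MulAut.mul_apply, ← pow_add, ← pow_add, add_comm]
  -- Here `T u * u = T ^ k u`. The value `k = 3` is the cubic for `T`, and `k = 5` yields the cubic
  -- for `T⁻¹`; each other value makes `u` trivial or identifies two distinct points of its orbit.
  interval_cases k
  · simp [hu] at h
  · simp [hu] at h
  · have h3 : (T ^ 3) u = (T ^ 0) u := by
      rw [← hmap 1, ← h, mul_comm, ← mul_assoc, pow_one, hsq, one_mul, hU0]
    exact absurd (hne (by norm_num) (by norm_num) h3) (by norm_num)
  · exact .inl (hcube T hTT (hcomm 3) h.symm)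
  · have h3 := hadd ((h7 0).symm.trans (hmap 3).symm)
    have h4 : (T ^ 1) u = (T ^ 3) u := by
      rw [← h, mul_comm, hU0] at h3
      simpa using h3
    exact absurd (hne (by norm_num) (by norm_num) h4) (by norm_num)
  · refine .inr (hcube T⁻¹ ?_ ?_ ?_)
    · rw [hinv]; exact hcomm 6
    · rw [hinv, ← pow_mul]; exact hcomm _
    · rw [hinv, ← pow_mul, mul_comm ((T ^ 6) u)]
      have h6 := hmap 6
      rw [h7 4] at h6
      have h18 : (T ^ (6 * 3)) u = (T ^ 4) u := by
        rw [show 6 * 3 = 4 + 7 + 7 by norm_num, h7, h7]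
      rw [h18, ← h6, h7 0, hU0]
  · have h3 := hadd ((h7 0).symm.trans (hmap 1).symm)
    have h4 : (T ^ 2) u = (T ^ 6) u := by
      rw [← h, mul_comm (T u)]; exact h3
    exact absurd (hne (by norm_num) (by norm_num) h4) (by norm_num)

/-- The product of the translates of `u` selected by the lowest three bits of `w`. -/
def bitProd (T : MulAut M) (u : M) (w : ℕ) : M :=
  ∏ i ∈ Finset.range 3, if w.testBit i then (T ^ i) u else 1

theorem bitProd_xor (hsq : ∀ v : M, v * v = 1) (u : M) (w w' : ℕ) :
    bitProd T u (w ^^^ w') = bitProd T u w * bitProd T u w' := by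
  rw [bitProd, bitProd, bitProd, ← Finset.prod_mul_distrib]
  refine Finset.prod_congr rfl fun i _ => ?_
  rw [Nat.testBit_xor]
  cases w.testBit i <;> cases w'.testBit i <;> simp [hsq]

theorem bitProd_rootPow (hcube : ∀ v : M, (T ^ 3) v = T v * v) (hsq : ∀ v : M, v * v = 1) (u : M)
    {e : ℕ} (he : e < 7) : bitProd T u (rootPow e) = (T ^ e) u := by
  have hs : ∀ n, (T ^ (n + 3)) u = (T ^ (n + 1)) u * (T ^ n) u := fun n => by
    rw [pow_add, MulAut.mul_apply, hcube, map_mul, ← MulAut.mul_apply, ← pow_succ]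
  have h3 := hs 0
  have h4 := hs 1
  have h5 := hs 2
  have h6 := hs 3
  norm_num at h3 h4 h5 h6
  rw [h3] at h5 h6
  have e6 : (T ^ 2) u * T u * (T u * u) = (T ^ 2) u * u := by
    rw [mul_assoc, ← mul_assoc (T u), hsq, one_mul]
  rw [h4, e6] at h6
  interval_cases e <;>
    simp [bitProd, rootPow, Finset.prod_range_succ, Nat.testBit, h3, h4, h5, h6, mul_comm,
      mul_left_comm]

/-- The sum of two distinct bit vectors is nonzero, hence a power of the root, and so corresponds to
a translate of `u`. -/
theorem bitProd_injective (hcube : ∀ v : M, (T ^ 3) v = T v * v) (hsq : ∀ v : M, v * v = 1) {u : M}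
    (hu : u ≠ 1) {w w' : ℕ} (hw : w < 8) (hw' : w' < 8) (h : bitProd T u w = bitProd T u w') :
    w = w' := by
  have hx : w ^^^ w' < 8 := Nat.xor_lt_two_pow (n := 3) hw hw'
  have h1 : bitProd T u (w ^^^ w') = 1 := by rw [bitProd_xor hsq, h, hsq]
  by_contra hne
  have hroot : ∀ x < 8, x ≠ 0 → ∃ e < 7, x = rootPow e := by decide
  obtain ⟨e, he, hxe⟩ := hroot _ hx (by simpa [Nat.xor_eq_zero_iff] using hne)
  rw [hxe, bitProd_rootPow hcube hsq u he] at h1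
  exact hu ((map_eq_one_iff _ (T ^ e).injective).1 h1)

end Automorphism

/-! ### Coding the nonabelian group of order 56 -/

section Semidirect

variable {M C : Type*} [CommGroup M] [CommGroup C] {φ : C →* MulAut M}

open SemidirectProduct

theorem right_pow (x : M ⋊[φ] C) (n : ℕ) : (x ^ n).right = x.right ^ n :=
  map_pow rightHom x n

theorem mul_inl (x : M ⋊[φ] C) (v : M) : x * inl v = inl (φ x.right v) * x := by
  ext <;> simp [mul_comm]

theorem pow_mul_inl (x : M ⋊[φ] C) (v : M) (n : ℕ) :
    x ^ n * inl v = inl ((φ x.right ^ n) v) * x ^ n := by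
  have h := mul_inl (x ^ n) v
  have hr : (x ^ n).right = x.right ^ n := map_pow rightHom x n
  rwa [hr, map_pow] at h

/-- The element `x ^ 7` lies in `M` and commutes with `x`, so the action fixes it; on a fixed `v`
the cubic reads `v = v * v = 1`. -/
theorem pow_seven_eq_one (hsq : ∀ v : M, v * v = 1) (x : M ⋊[φ] C)
    (hcube : ∀ v : M, (φ x.right ^ 3) v = φ x.right v * v) (hx : x.right ^ 7 = 1) : x ^ 7 = 1 := by
  have hr : (x ^ 7).right = 1 := by rw [← hx]; exact map_pow rightHom x 7
  have hl : x ^ 7 = inl (x ^ 7).left := by ext <;> simp [hr]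
  have hcomm : x * x ^ 7 = x ^ 7 * x := (pow_succ' x 7).symm.trans (pow_succ x 7)
  rw [hl, mul_inl] at hcomm
  have hfix := inl_injective (mul_right_cancel hcomm)
  have h3 := hcube (x ^ 7).left
  rw [pow_succ, pow_two, MulAut.mul_apply, MulAut.mul_apply, hfix, hfix, hfix, hsq] at h3
  rw [hl, h3, map_one]

theorem isCoding_semidirect (hsq : ∀ v : M, v * v = 1) (x : M ⋊[φ] C)
    (hcube : ∀ v : M, (φ x.right ^ 3) v = φ x.right v * v) (hx : x.right ^ 7 = 1)
    (hx1 : x.right ≠ 1) {u : M} (hu : u ≠ 1) {j : ℕ} (hj : j < 7) :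
    IsCoding j x (inl u * x ^ j) fun s => inl (bitProd (φ x.right) u s.1) * x ^ s.2 := by
  have hx7 := pow_seven_eq_one hsq x hcube hx
  have hmod : ∀ n, x ^ (n % 7) = x ^ n := fun n => by
    conv_rhs => rw [← Nat.div_add_mod n 7, pow_add, pow_mul, hx7, one_pow, one_mul]
  have hTmod : ∀ n, φ x.right ^ (n % 7) = φ x.right ^ n := fun n => by
    conv_rhs => rw [← Nat.div_add_mod n 7, pow_add, pow_mul, ← map_pow φ, hx, map_one, one_pow,
      one_mul]
  have hinv : x⁻¹ = x ^ 6 := by rw [inv_eq_iff_mul_eq_one, ← pow_succ', hx7]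
  have hinv' : (inl u * x ^ j)⁻¹ = x ^ (7 - j) * inl u := by
    rw [inv_eq_iff_mul_eq_one, mul_assoc, ← mul_assoc (x ^ j), ← pow_add,
      Nat.add_sub_cancel' hj.le, hx7, one_mul, ← map_mul, hsq, map_one]
  refine ⟨by simp [bitProd], ?_, ?_⟩
  · rintro ⟨w, e⟩ ⟨w', e'⟩ hw he hw' he' h
    dsimp only at hw he hw' he' h ⊢
    have hr := congrArg rightHom h
    simp only [map_mul, rightHom_inl, one_mul, map_pow] at hr
    have hfact : Fact (Nat.Prime 7) := ⟨by norm_num⟩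
    have hord : orderOf x.right = 7 := orderOf_eq_prime hx hx1
    have hee : e = e' := pow_injOn_Iio_orderOf (x := x.right) (by simpa [hord] using he)
      (by simpa [hord] using he') hr
    subst hee
    rw [bitProd_injective hcube hsq hu hw hw' (inl_injective (mul_right_cancel h))]
  · rintro ⟨w, e⟩ l hw he
    dsimp only at hw he
    cases l
    · simp only [wordStep, Letter.eval, hmod, pow_succ, mul_assoc]
    · simp only [wordStep, Letter.eval, hmod, hinv, pow_add, mul_assoc]
    · simp only [wordStep, Letter.eval, hmod, bitProd_xor hsq, bitProd_rootPow hcube hsq u he,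
        map_mul, mul_assoc]
      rw [← mul_assoc (x ^ e), pow_mul_inl, pow_add, mul_assoc]
    · simp only [wordStep, Letter.eval, hmod, bitProd_xor hsq,
        bitProd_rootPow hcube hsq u (Nat.mod_lt _ (by norm_num : 7 > 0)), map_mul, mul_assoc, hinv']
      rw [← mul_assoc (x ^ e), ← pow_add, pow_mul_inl, hTmod]

/-- Generators of a nonabelian group of order `56` can be coded after inverting some of them. -/
theorem exists_isCoding (hM : Nat.card M = 8) (hC : Nat.card C = 7) (hsq : ∀ v : M, v * v = 1)
    (hφ : φ ≠ 1) {x y : M ⋊[φ] C} (hx : x.right ≠ 1) (hy : y ∉ Subgroup.zpowers x) :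
    ∃ x' y' : M ⋊[φ] C, (x' = x ∨ x' = x⁻¹) ∧ (y' = y ∨ y' = y⁻¹) ∧
      ∃ j < 4, ∃ nf, IsCoding j x' y' nf ∧ y'.right = x'.right ^ j := by
  have hfact : Fact (Nat.Prime 7) := ⟨by norm_num⟩
  classical
  have hC7 : ∀ k : C, k ^ 7 = 1 := fun k => hC ▸ pow_card_eq_one'
  have hgen : ∀ k : C, k ≠ 1 → ∀ m : C, ∃ n < 7, m = k ^ n := by
    intro k hk m
    have hord : orderOf k = 7 := orderOf_eq_prime (hC7 k) hk
    have hm : m ∈ Subgroup.zpowers k := mem_zpowers_of_prime_card hC hk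
    have hfin : Finite C := Nat.finite_of_card_ne_zero (by omega)
    obtain ⟨n, hn, hn'⟩ := (isOfFinOrder_of_finite k).mem_zpowers_iff_mem_range_orderOf.1 hm |>
      Finset.mem_image.1
    exact ⟨n, by simpa [hord] using Finset.mem_range.1 hn, hn'.symm⟩
  have hT1 : φ x.right ≠ 1 := by
    intro h
    apply hφ
    ext m : 1
    obtain ⟨n, -, rfl⟩ := hgen _ hx m
    simp [h]
  have hT7 : φ x.right ^ 7 = 1 := by rw [← map_pow, hC7, map_one]
  obtain ⟨x', hx', hcube⟩ : ∃ x' : M ⋊[φ] C, (x' = x ∨ x' = x⁻¹) ∧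
      ∀ v, (φ x'.right ^ 3) v = φ x'.right v * v := by
    rcases cube_apply_or hM hsq hT7 hT1 with h | h
    · exact ⟨x, .inl rfl, h⟩
    · exact ⟨x⁻¹, .inr rfl, by simpa using h⟩
  have hx1 : x'.right ≠ 1 := by rcases hx' with rfl | rfl <;> simpa using hx
  have hy1 : y ∉ Subgroup.zpowers x' := by rcases hx' with rfl | rfl <;> simpa using hy
  have key : ∀ z : M ⋊[φ] C, z ∉ Subgroup.zpowers x' → ∀ j < 7, z.right = x'.right ^ j →
      ∃ nf, IsCoding j x' z nf := by
    intro z hz j hj hzj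
    have hzr : (z * (x' ^ j)⁻¹).right = 1 := by
      have : (x' ^ j).right = x'.right ^ j := map_pow rightHom x' j
      rw [mul_right, inv_right, this, hzj, mul_inv_cancel]
    have hzu : z * (x' ^ j)⁻¹ = inl (z * (x' ^ j)⁻¹).left := by
      ext
      · simp
      · rw [hzr]; simp
    have hu : (z * (x' ^ j)⁻¹).left ≠ 1 := by
      intro h
      rw [h, map_one, mul_inv_eq_one] at hzu
      exact hz (hzu ▸ pow_mem (Subgroup.mem_zpowers x') j)
    have := isCoding_semidirect hsq x' hcube (hC7 _) hx1 hu hj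
    rw [← hzu, inv_mul_cancel_right] at this
    exact ⟨_, this⟩
  obtain ⟨j, hj, hyj⟩ := hgen _ hx1 y.right
  -- Inverting `y` replaces `j` by `7 - j`, which brings the exponent below `4`.
  rcases Nat.lt_or_ge j 4 with h4 | h4
  · obtain ⟨nf, hnf⟩ := key y hy1 j hj hyj
    exact ⟨x', y, hx', .inl rfl, j, h4, nf, hnf, hyj⟩
  · have hyj' : y⁻¹.right = x'.right ^ (7 - j) := by
      rw [inv_right, hyj, inv_eq_iff_mul_eq_one, ← pow_add, Nat.add_sub_cancel' hj.le, hC7]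
    obtain ⟨nf, hnf⟩ := key y⁻¹ (by simpa using hy1) (7 - j) (by omega) hyj'
    exact ⟨x', y⁻¹, hx', .inr rfl, 7 - j, by omega, nf, hnf, hyj'⟩

theorem semidirect_action_ne_one (h : ∃ x y : M ⋊[φ] C, x * y ≠ y * x) : φ ≠ 1 := by
  rintro rfl
  obtain ⟨x, y, hxy⟩ := h
  apply hxy
  ext <;> simp [mul_comm]

/-- Characters of a nonabelian group of order `56` are trivial on the normal subgroup of
order `8`. -/
theorem char_inl_eq_one {R : Type*} [CommMonoid R] (hM : Nat.card M = 8) (hC : Nat.card C = 7)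
    (hsq : ∀ v : M, v * v = 1) (hφ : φ ≠ 1) (ρ : M ⋊[φ] C →* R) (v : M) : ρ (inl v) = 1 := by
  obtain ⟨k, hk⟩ : ∃ k, φ k ≠ 1 := by
    by_contra! h
    exact hφ (MonoidHom.ext h)
  have hk7 : φ k ^ 7 = 1 := by rw [← map_pow, ← hC, pow_card_eq_one', map_one]
  have hconj : ∀ (m : C) (w : M), ρ (inl (φ m w)) = ρ (inl w) := by
    intro m w
    rw [inl_aut, map_mul, mul_comm, ← map_mul, map_inv inr, inv_mul_cancel_left]
  obtain ⟨m, hm⟩ : ∃ m, (φ m ^ 3) v = φ m v * v := by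
    rcases cube_apply_or hM hsq hk7 hk with h | h
    · exact ⟨k, h v⟩
    · exact ⟨k⁻¹, by simpa using h v⟩
  -- As `ρ` is constant on conjugates, the cubic gives `ρ v = ρ v * ρ v`.
  have h1 : ρ (inl v) = ρ (inl v) * ρ (inl v) := by
    conv_lhs => rw [← hconj (m ^ 3) v, map_pow, hm, map_mul, map_mul, hconj]
  have h2 : ρ (inl v) * ρ (inl v) = 1 := by rw [← map_mul, ← map_mul, hsq, map_one, map_one]
  exact h1.trans h2

end Semidirect

/-! ### Case analysis on the generators -/

/-- The Cayley graph has a hamiltonian cycle. -/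
def HasHamiltonianCycle {G : Type*} [Group G] [DecidableEq G] (S : Set G) : Prop :=
  ∃ (g : G) (C : (SimpleGraph.mulCayley S).Walk g g), C.IsHamiltonianCycle

theorem IsCoding.nf_pow {K : Type*} [Group K] {j : ℕ} {x y : K} {nf : ℕ × ℕ → K}
    (h : IsCoding j x y nf) {e : ℕ} (he : e < 7) : nf (0, e) = x ^ e := by
  induction e with
  | zero => simpa using h.zero
  | succ e ih =>
    have h1 := h.step (0, e) .a (by norm_num) (by simp; omega)
    simp only [wordStep, Letter.eval, Nat.mod_eq_of_lt he] at h1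
    rw [h1, ih (by omega), pow_succ]

theorem IsCoding.pow_seven {K : Type*} [Group K] {j : ℕ} {x y : K} {nf : ℕ × ℕ → K}
    (h : IsCoding j x y nf) : x ^ 7 = 1 := by
  have h1 := h.step (0, 6) .a (by norm_num) (by norm_num)
  rw [h.nf_pow (by norm_num), show wordStep j (0, 6) .a = (0, 0) from rfl, h.zero] at h1
  rw [pow_succ, h1, Letter.eval]

/-- Subtracting a multiple of a second crossed homomorphism makes the value at `a` vanish. -/
theorem IsCrossedHom.exists_normalized {G R : Type*} [Group G] [Field R] {χ : G →* R} {c κ : G → R}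
    (hc : IsCrossedHom χ c) (hκ : IsCrossedHom χ κ) {a : G} (ha : κ a ≠ 0) :
    ∃ r : R, IsCrossedHom χ (fun g => c g - r * κ g) ∧ c a - r * κ a = 0 := by
  refine ⟨c a / κ a, fun g g' => ?_, by field_simp; ring⟩
  dsimp only
  rw [hc, hκ]
  ring

/-- A finite group mapping onto a nonabelian group of order `56` with kernel of prime order `p > 5`,
a character factoring through the quotient of order `7`, and a symmetric generating set. -/
structure IsCayleySetup {M C G : Type*} [CommGroup M] [CommGroup C] {φ : C →* MulAut M} [Group G]
    [Fintype G] {p : ℕ} (q : G →* M ⋊[φ] C) (χ : G →* ZMod p) (S : Set G) : Prop where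
  card_left : Nat.card M = 8
  card_right : Nat.card C = 7
  mul_self : ∀ v : M, v * v = 1
  noncomm : ∃ x y : M ⋊[φ] C, x * y ≠ y * x
  surj : Function.Surjective q
  prime : p.Prime
  five_lt : 5 < p
  card : Fintype.card G = 56 * p
  card_ker : Nat.card q.ker = p
  char : ∀ g, (q g).right = 1 → χ g = 1
  inv_mem : ∀ s ∈ S, s⁻¹ ∈ S
  gen : Subgroup.closure S = ⊤

namespace IsCayleySetup

variable {M C G : Type*} [CommGroup M] [CommGroup C] {φ : C →* MulAut M} [Group G]
  [Fintype G] {p : ℕ} {q : G →* M ⋊[φ] C} {χ : G →* ZMod p} {S : Set G}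
  {c κ : G → ZMod p} {a b d : G}

theorem action_ne_one (h : IsCayleySetup q χ S) : φ ≠ 1 :=
  semidirect_action_ne_one h.noncomm

theorem char_eq_of_right_eq (h : IsCayleySetup q χ S) {n : ℕ}
    (hab : (q b).right = (q a).right ^ n) : χ b = χ a ^ n := by
  have hr : (q (a ^ n)).right = (q a).right ^ n := by
    rw [map_pow, right_pow]
  have h1 := h.char (b * (a ^ n)⁻¹) (by
    rw [map_mul, map_inv, SemidirectProduct.mul_right, SemidirectProduct.inv_right, hr, hab,
      mul_inv_cancel])
  rw [← map_pow, ← inv_mul_cancel_right b (a ^ n), map_mul, h1, one_mul]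

theorem exists_coding (h : IsCayleySetup q χ S) (ha : a ∈ S) (hb : b ∈ S) (ha1 : (q a).right ≠ 1)
    (hab : q b ∉ Subgroup.zpowers (q a)) :
    ∃ a' ∈ S, ∃ b' ∈ S, (a' = a ∨ a' = a⁻¹) ∧ (b' = b ∨ b' = b⁻¹) ∧ ∃ j < 4, ∃ nf,
      IsCoding j (q a') (q b') nf ∧ (q b').right = (q a').right ^ j ∧ χ a' ^ 7 = 1 ∧
        χ b' = χ a' ^ j := by
  obtain ⟨x, y, hx, hy, j, hj, nf, hnf, hright⟩ :=
    _root_.exists_isCoding h.card_left h.card_right h.mul_self h.action_ne_one ha1 hab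
  obtain ⟨a', ha', haS, rfl⟩ : ∃ a', (a' = a ∨ a' = a⁻¹) ∧ a' ∈ S ∧ q a' = x := by
    rcases hx with rfl | rfl
    · exact ⟨a, .inl rfl, ha, rfl⟩
    · exact ⟨a⁻¹, .inr rfl, h.inv_mem a ha, map_inv q a⟩
  obtain ⟨b', hb', hbS, rfl⟩ : ∃ b', (b' = b ∨ b' = b⁻¹) ∧ b' ∈ S ∧ q b' = y := by
    rcases hy with rfl | rfl
    · exact ⟨b, .inl rfl, hb, rfl⟩
    · exact ⟨b⁻¹, .inr rfl, h.inv_mem b hb, map_inv q b⟩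
  refine ⟨a', haS, b', hbS, ha', hb', j, hj, nf, hnf, hright, ?_, h.char_eq_of_right_eq hright⟩
  rw [← map_pow]
  apply h.char
  rw [map_pow, hnf.pow_seven]
  rfl

theorem two_ne_zero (h : IsCayleySetup q χ S) : (2 : ZMod p) ≠ 0 := by
  have hp := h.five_lt
  have hd : ¬ p ∣ 2 := fun hd => absurd (Nat.le_of_dvd (by norm_num) hd) (by omega)
  exact_mod_cast mt (ZMod.natCast_eq_zero_iff 2 p).1 hd

theorem hasHamiltonianCycle_of_crossedHom [DecidableEq G] (h : IsCayleySetup q χ S)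
    (hc : IsCrossedHom χ c)
    (ha : a ∈ S) (hb : b ∈ S) (ha1 : (q a).right ≠ 1) (hab : q b ∉ Subgroup.zpowers (q a))
    (hca : c a = 0) (hcb : c b ≠ 0) : HasHamiltonianCycle S := by
  have := Fact.mk h.prime
  obtain ⟨a', ha', b', hb', haa, hbb, j, hj, nf, hnf, -, hχa, hχb⟩ := h.exists_coding ha hb ha1 hab
  have hca' := (hc.eq_zero_iff haa).2 hca
  have hcb' := mt (hc.eq_zero_iff hbb).1 hcb
  refine hnf.exists_isHamiltonianCycle_of_cycleWord h.inv_mem ha' hb' h.prime h.card h.card_ker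
    (isCycleWord_cycleWord j hj) fun hone => ?_
  have hw := hc.word (by omega) hχa hχb (cycleWord j) (e := 0) (by norm_num)
  rw [hone, hc.map_one, Finset.sum_eq_single_of_mem 0 (by simp),
    coeffB_cycleWord j hj 0 (by norm_num), hca'] at hw
  · exact mul_ne_zero h.two_ne_zero hcb' (by simpa using hw.symm)
  · intro i hi hi0
    rw [coeffB_cycleWord j hj i (Finset.mem_range.1 hi), hca']
    simp [hi0]

/-- If neither cycle word lifted, `c a` and `c b` (up to sign) would solve a homogeneous linear
system with determinant ±14 or ±28, which is invertible modulo a prime `p > 5` other than `7`. -/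
theorem hasHamiltonianCycle_of_hom [DecidableEq G] (h : IsCayleySetup q χ S)
    (hc : IsCrossedHom χ c)
    (hχ : ∀ g, χ g = 1) (hp7 : p ≠ 7)
    (ha : a ∈ S) (hb : b ∈ S) (ha1 : (q a).right ≠ 1) (hab : q b ∉ Subgroup.zpowers (q a))
    (hcab : c a ≠ 0 ∨ c b ≠ 0) : HasHamiltonianCycle S := by
  have := Fact.mk h.prime
  obtain ⟨a', ha', b', hb', haa, hbb, j, hj, nf, hnf, -, hχa, hχb⟩ := h.exists_coding ha hb ha1 hab
  rw [Ne, ← hc.eq_zero_iff haa, Ne, ← hc.eq_zero_iff hbb] at hcab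
  have hsum : ∀ w : List Letter, c (w.map (Letter.eval a' b')).prod =
      ((∑ i ∈ Finset.range 7, coeffA j i 0 w : ℤ) : ZMod p) * c a' +
        ((∑ i ∈ Finset.range 7, coeffB j i 0 w : ℤ) : ZMod p) * c b' := by
    intro w
    have hw := hc.word (by omega) hχa hχb w (e := 0) (by norm_num)
    simp only [hχ, one_pow, one_mul, Finset.sum_add_distrib, ← Finset.sum_mul] at hw
    rw [hw]
    push_cast
    rfl
  have hfive := h.five_lt
  by_contra hno
  have hvan : ∀ w, IsCycleWord j w → c (w.map (Letter.eval a' b')).prod = 0 := by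
    intro w hw
    by_contra hne
    exact hno (hnf.exists_isHamiltonianCycle_of_cycleWord h.inv_mem ha' hb' h.prime h.card
      h.card_ker hw fun hone => hne (by rw [hone, hc.map_one]))
  have h1 := hvan _ (isCycleWord_cycleWord j hj)
  have h2 := hvan _ (isCycleWord_altCycleWord j hj)
  rw [hsum] at h1 h2
  have hdet := exponent_det j hj
  set A := ∑ i ∈ Finset.range 7, coeffA j i 0 (cycleWord j)
  set B := ∑ i ∈ Finset.range 7, coeffB j i 0 (cycleWord j)
  set A' := ∑ i ∈ Finset.range 7, coeffA j i 0 (altCycleWord j)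
  set B' := ∑ i ∈ Finset.range 7, coeffB j i 0 (altCycleWord j)
  have hdet0 : ((A * B' - B * A' : ℤ) : ZMod p) ≠ 0 := by
    rw [Ne, ZMod.intCast_zmod_eq_zero_iff_dvd, ← dvd_abs]
    intro hd
    have hd28 : (p : ℤ) ∣ 28 := by
      simp only [Finset.mem_insert, Finset.mem_singleton] at hdet
      rcases hdet with hdet | hdet
      · exact (hdet ▸ hd).trans ⟨2, by norm_num⟩
      · exact hdet ▸ hd
    have hd28' : p ∣ 28 := by exact_mod_cast hd28
    have hmem : p ∈ Nat.divisors 28 := Nat.mem_divisors.2 ⟨hd28', by norm_num⟩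
    rw [show Nat.divisors 28 = {1, 2, 4, 7, 14, 28} by decide +kernel] at hmem
    simp only [Finset.mem_insert, Finset.mem_singleton] at hmem
    have hprime := h.prime
    rcases hmem with rfl | rfl | rfl | rfl | rfl | rfl
    · omega
    · omega
    · omega
    · exact hp7 rfl
    · norm_num at hprime
    · norm_num at hprime
  push_cast at hdet0
  rcases hcab with hne | hne
  · refine mul_ne_zero hdet0 hne ?_
    linear_combination (B' : ZMod p) * h1 - (B : ZMod p) * h2
  · refine mul_ne_zero hdet0 hne ?_
    linear_combination (A : ZMod p) * h2 - (A' : ZMod p) * h1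

theorem hasHamiltonianCycle_of_mem_ker [DecidableEq G] (h : IsCayleySetup q χ S)
    (hc : IsCrossedHom χ c)
    (hinj : ∀ g, q g = 1 → c g = 0 → g = 1)
    (ha : a ∈ S) (hb : b ∈ S) (hd : d ∈ S) (ha1 : (q a).right ≠ 1)
    (hab : q b ∉ Subgroup.zpowers (q a)) (hca : c a = 0) (hcb : c b = 0) (hcd : c d ≠ 0)
    (hqd : q d = 1) : HasHamiltonianCycle S := by
  obtain ⟨a', ha', b', hb', haa, hbb, j, hj, nf, hnf, -, hχa, hχb⟩ := h.exists_coding ha hb ha1 hab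
  exact hnf.exists_isHamiltonianCycle_of_mem_ker h.inv_mem ha' hb' hd h.prime h.card h.card_ker hc
    hinj hj hχa hχb (h.char d (by rw [hqd]; rfl)) ((hc.eq_zero_iff haa).2 hca)
    ((hc.eq_zero_iff hbb).2 hcb) hqd (by rintro rfl; exact hcd hc.map_one)

/-- A hamiltonian path in `a` and `b` is closed by `d`, used once: the path has value zero and `c d
≠ 0`, so the product is nontrivial. -/
theorem hasHamiltonianCycle_of_mem_zpowers [DecidableEq G] (h : IsCayleySetup q χ S)
    (hc : IsCrossedHom χ c)
    (ha : a ∈ S) (hb : b ∈ S) (hd : d ∈ S) (ha1 : (q a).right ≠ 1)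
    (hab : q b ∉ Subgroup.zpowers (q a)) (hca : c a = 0) (hcb : c b = 0) (hcd : c d ≠ 0)
    (hb1 : (q b).right = 1) (had : q d ∈ Subgroup.zpowers (q a)) (hqd : q d ≠ 1) :
    HasHamiltonianCycle S := by
  classical
  have := Fact.mk h.prime
  have hseven : Fact (Nat.Prime 7) := ⟨by norm_num⟩
  obtain ⟨a', ha', b', hb', haa, hbb, j, hj, nf, hnf, hright, hχa, hχb⟩ :=
    h.exists_coding ha hb ha1 hab
  have hca' := (hc.eq_zero_iff haa).2 hca
  have hcb' := (hc.eq_zero_iff hbb).2 hcb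
  have ha1' : (q a').right ≠ 1 := by rcases haa with rfl | rfl <;> simpa using ha1
  have hb1' : (q b').right = 1 := by rcases hbb with rfl | rfl <;> simpa using hb1
  have had' : q d ∈ Subgroup.zpowers (q a') := by rcases haa with rfl | rfl <;> simpa using had
  have hx7 := hnf.pow_seven
  have hj0 : j = 0 := by
    have hr7 : (q a').right ^ 7 = 1 := by
      rw [← right_pow, hx7]; rfl
    have hord : orderOf (q a').right = 7 := orderOf_eq_prime hr7 ha1'
    have hdvd : 7 ∣ j := hord ▸ orderOf_dvd_of_pow_eq_one (hright.symm.trans hb1')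
    omega
  subst hj0
  have hord : orderOf (q a') = 7 := orderOf_eq_prime hx7 fun h1 => ha1' (by rw [h1]; rfl)
  have hfin : IsOfFinOrder (q a') := isOfFinOrder_iff_pow_eq_one.2 ⟨7, by norm_num, hx7⟩
  obtain ⟨n, hn, hn'⟩ := Finset.mem_image.1 (hfin.mem_zpowers_iff_mem_range_orderOf.1 had')
  rw [hord, Finset.mem_range] at hn
  have hn0 : n ≠ 0 := by rintro rfl; exact hqd (by simpa using hn'.symm)
  -- Up to inverting `d`, its image is the inverse of the endpoint `q a' ^ m` of one of the three
  -- path words.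
  obtain ⟨d', hdd, hd', m, hm4, hm0, hdm⟩ : ∃ d', (d' = d ∨ d' = d⁻¹) ∧ d' ∈ S ∧
      ∃ m < 4, m ≠ 0 ∧ q a' ^ m * q d' = 1 := by
    rcases Nat.lt_or_ge n 4 with h4 | h4
    · exact ⟨d⁻¹, .inr rfl, h.inv_mem d hd, n, h4, hn0, by rw [map_inv, ← hn', mul_inv_cancel]⟩
    · refine ⟨d, .inl rfl, hd, 7 - n, by omega, by omega, ?_⟩
      rw [← hn', ← pow_add, Nat.sub_add_cancel hn.le, hx7]
  obtain ⟨hpath, hlen, hrun⟩ := isPathWord_pathWord m hm4 hm0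
  refine hnf.exists_isHamiltonianCycle h.inv_mem ha' hb' h.prime h.card h.card_ker hpath hlen.ge
    (M := [d']) (by simpa using hd') (by simp [hlen]) ?_ ?_
  · rw [map_mul, ← hnf.run_zero, hrun, hnf.nf_pow (by omega)]
    simpa using hdm
  · intro hone
    have hw := hc.word (by norm_num) hχa hχb (pathWord m) (e := 0) (by norm_num)
    rw [Finset.sum_eq_zero (fun i _ => by simp [hca', hcb']), pow_zero, one_mul] at hw
    have h1 := hc ((pathWord m).map (Letter.eval a' b')).prod d'
    rw [List.prod_singleton] at hone
    rw [hone, hw, hc.map_one, zero_add] at h1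
    have hunit : χ ((pathWord m).map (Letter.eval a' b')).prod ≠ 0 := by
      intro h0
      have := congrArg χ hone
      rw [map_mul, h0, zero_mul, map_one] at this
      exact zero_ne_one this
    exact mul_ne_zero hunit (mt (hc.eq_zero_iff hdd).1 hcd) h1.symm

theorem exists_right_ne_one (h : IsCayleySetup q χ S) : ∃ a ∈ S, (q a).right ≠ 1 := by
  by_contra! hno
  have hle : Subgroup.closure S ≤ (SemidirectProduct.rightHom.comp q).ker :=
    (Subgroup.closure_le _).2 fun s hs => hno s hs
  rw [h.gen] at hle
  have hC : Subsingleton C := ⟨fun x y => by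
    obtain ⟨g, hg⟩ := h.surj (SemidirectProduct.inr x)
    obtain ⟨g', hg'⟩ := h.surj (SemidirectProduct.inr y)
    have h1 : (q g).right = 1 := hle (Subgroup.mem_top g)
    have h2 : (q g').right = 1 := hle (Subgroup.mem_top g')
    rw [hg] at h1
    rw [hg'] at h2
    simpa using h1.trans h2.symm⟩
  have := h.card_right
  rw [Nat.card_of_subsingleton (1 : C)] at this
  omega

theorem exists_notMem_zpowers (h : IsCayleySetup q χ S) (a : G) :
    ∃ b ∈ S, q b ∉ Subgroup.zpowers (q a) := by
  by_contra! hno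
  have hle : Subgroup.closure S ≤ (Subgroup.zpowers (q a)).comap q :=
    (Subgroup.closure_le _).2 fun s hs => hno s hs
  rw [h.gen] at hle
  obtain ⟨x, y, hxy⟩ := h.noncomm
  obtain ⟨g, rfl⟩ := h.surj x
  obtain ⟨g', rfl⟩ := h.surj y
  obtain ⟨m, hm⟩ := Subgroup.mem_zpowers_iff.1 (hle (Subgroup.mem_top g))
  obtain ⟨n, hn⟩ := Subgroup.mem_zpowers_iff.1 (hle (Subgroup.mem_top g'))
  apply hxy
  rw [← hm, ← hn, ← zpow_add, ← zpow_add, add_comm]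

theorem exists_crossedHom_ne_zero (h : IsCayleySetup q χ S) (hc : IsCrossedHom χ c)
    (hinj : ∀ g, q g = 1 → c g = 0 → g = 1) : ∃ d ∈ S, c d ≠ 0 := by
  by_contra! hno
  have hzero : ∀ g, c g = 0 := by
    intro g
    have hg : g ∈ Subgroup.closure S := h.gen ▸ Subgroup.mem_top g
    induction hg using Subgroup.closure_induction with
    | mem s hs => exact hno s hs
    | one => exact hc.map_one
    | mul x y _ _ hx hy => rw [hc, hx, hy, mul_zero, add_zero]
    | inv x _ hx => exact hc.map_inv_eq_zero hx
  have hker : Subsingleton q.ker := ⟨fun x y =>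
    Subtype.ext ((hinj x x.2 (hzero x)).trans (hinj y y.2 (hzero y)).symm)⟩
  have := h.card_ker
  rw [Nat.card_of_subsingleton (1 : q.ker)] at this
  have := h.five_lt
  omega

/-- Both `q a` and its `C`-component have order `7`, so the projection to `C` is injective on the
powers of `q a`. -/
theorem right_ne_one_of_mem_zpowers (h : IsCayleySetup q χ S) (ha : a ∈ S) (hb : b ∈ S)
    (ha1 : (q a).right ≠ 1) (hab : q b ∉ Subgroup.zpowers (q a))
    (had : q d ∈ Subgroup.zpowers (q a)) (hqd : q d ≠ 1) : (q d).right ≠ 1 := by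
  have hseven : Fact (Nat.Prime 7) := ⟨by norm_num⟩
  obtain ⟨a', -, b', -, haa, -, j, -, nf, hnf, -⟩ := h.exists_coding ha hb ha1 hab
  have hx7 : q a ^ 7 = 1 := by
    have := hnf.pow_seven
    rcases haa with rfl | rfl <;> simpa using this
  have hr7 : (q a).right ^ 7 = 1 := by
    rw [← right_pow, hx7]; rfl
  obtain ⟨n, hn⟩ := Subgroup.mem_zpowers_iff.1 had
  intro hdr
  have hr : (q a).right ^ n = 1 := by
    rw [← hdr, ← hn]; exact (map_zpow (SemidirectProduct.rightHom (φ := φ)) _ n).symm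
  apply hqd
  rw [← hn, ← orderOf_dvd_iff_zpow_eq_one]
  rw [← orderOf_dvd_iff_zpow_eq_one, orderOf_eq_prime hr7 ha1] at hr
  exact (Int.natCast_dvd_natCast.2 (orderOf_dvd_of_pow_eq_one hx7)).trans hr

theorem hasHamiltonianCycle_of_second [DecidableEq G] (h : IsCayleySetup q χ S)
    (hc : IsCrossedHom χ c)
    (hinj : ∀ g, q g = 1 → c g = 0 → g = 1) (hκ : IsCrossedHom χ κ)
    (hκ0 : ∀ g, κ g = 0 ↔ (q g).right = 1) : HasHamiltonianCycle S := by
  have := Fact.mk h.prime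
  obtain ⟨a, ha, ha1⟩ := h.exists_right_ne_one
  -- The second crossed homomorphism vanishes on the kernel of `q`, so subtracting a multiple of it
  -- preserves `hinj`.
  wlog hca : c a = 0 generalizing c
  · obtain ⟨r, hr, hra⟩ := hc.exists_normalized hκ (mt (hκ0 a).1 ha1)
    refine this hr (fun g hg hg0 => hinj g hg ?_) hra
    have : κ g = 0 := (hκ0 g).2 (by rw [hg]; rfl)
    simpa [this] using hg0
  by_cases hA : ∃ b ∈ S, q b ∉ Subgroup.zpowers (q a) ∧ c b ≠ 0
  · obtain ⟨b, hb, hab, hcb⟩ := hA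
    exact h.hasHamiltonianCycle_of_crossedHom hc ha hb ha1 hab hca hcb
  push Not at hA
  obtain ⟨d, hd, hcd⟩ := h.exists_crossedHom_ne_zero hc hinj
  have had : q d ∈ Subgroup.zpowers (q a) := by
    by_contra hn; exact hcd (hA d hd hn)
  obtain ⟨b, hb, hab⟩ := h.exists_notMem_zpowers a
  have hcb := hA b hb hab
  by_cases hqd : q d = 1
  · exact h.hasHamiltonianCycle_of_mem_ker hc hinj ha hb hd ha1 hab hca hcb hcd hqd
  by_cases hb1 : (q b).right = 1
  · exact h.hasHamiltonianCycle_of_mem_zpowers hc ha hb hd ha1 hab hca hcb hcd hb1 had hqd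
  have hd1 := h.right_ne_one_of_mem_zpowers ha hb ha1 hab had hqd
  -- Renormalise to vanish at `d` instead of `a`: the multiple `r` is nonzero, so the new value `-r
  -- * κ b` at `b` is nonzero.
  obtain ⟨r, hr, hrd⟩ := hc.exists_normalized hκ (mt (hκ0 d).1 hd1)
  refine h.hasHamiltonianCycle_of_crossedHom hr hd hb hd1
    (fun hbd => hab (Subgroup.zpowers_le.2 had hbd)) hrd ?_
  have hr0 : r ≠ 0 := by rintro rfl; exact hcd (by simpa using hrd)
  rw [hcb, zero_sub]
  exact neg_ne_zero.2 (mul_ne_zero hr0 (mt (hκ0 b).1 hb1))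

theorem hasHamiltonianCycle_of_char_eq_one [DecidableEq G] (h : IsCayleySetup q χ S)
    (hc : IsCrossedHom χ c)
    (hinj : ∀ g, q g = 1 → c g = 0 → g = 1) (hχ : ∀ g, χ g = 1) (hp7 : p ≠ 7) :
    HasHamiltonianCycle S := by
  obtain ⟨a, ha, ha1⟩ := h.exists_right_ne_one
  obtain ⟨b, hb, hab⟩ := h.exists_notMem_zpowers a
  by_cases hcab : c a ≠ 0 ∨ c b ≠ 0
  · exact h.hasHamiltonianCycle_of_hom hc hχ hp7 ha hb ha1 hab hcab
  push Not at hcab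
  obtain ⟨d, hd, hcd⟩ := h.exists_crossedHom_ne_zero hc hinj
  by_cases had : q d ∈ Subgroup.zpowers (q a)
  · by_cases hqd : q d = 1
    · exact h.hasHamiltonianCycle_of_mem_ker hc hinj ha hb hd ha1 hab hcab.1 hcab.2 hcd hqd
    · exact h.hasHamiltonianCycle_of_hom hc hχ hp7 hd hb
        (h.right_ne_one_of_mem_zpowers ha hb ha1 hab had hqd)
        (fun hbd => hab (Subgroup.zpowers_le.2 had hbd)) (.inl hcd)
  · exact h.hasHamiltonianCycle_of_hom hc hχ hp7 ha hd ha1 had (.inr hcd)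

theorem char_eq_one_iff (h : IsCayleySetup q χ S) (hχ : ∃ g, χ g ≠ 1) (g : G) :
    χ g = 1 ↔ (q g).right = 1 := by
  refine ⟨fun hg => ?_, h.char g⟩
  by_contra hne
  obtain ⟨g', hg'⟩ := hχ
  have hseven : Fact (Nat.Prime 7) := ⟨by norm_num⟩
  have hfin : Finite C := Nat.finite_of_card_ne_zero (by rw [h.card_right]; norm_num)
  have hm := mem_powers_of_prime_card h.card_right hne (g' := (q g').right)
  obtain ⟨n, hn⟩ := hm
  exact hg' (by rw [h.char_eq_of_right_eq hn.symm, hg, one_pow])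

end IsCayleySetup

/-! ### The action on the cyclic factor, and the main theorem -/

section Cyclic

variable {p : ℕ}

theorem toAdd_mulAut_apply_eq (f : MulAut (Multiplicative (ZMod p)))
    (x : Multiplicative (ZMod p)) :
    (f x).toAdd = (f (Multiplicative.ofAdd 1)).toAdd * x.toAdd := by
  have h := ZMod.map_smul (AddMonoidHom.toMultiplicative.symm f.toMonoidHom) x.toAdd (1 : ZMod p)
  rw [smul_eq_mul, mul_one, smul_eq_mul, mul_comm] at h
  exact h

/-- The factor by which an automorphism of a cyclic group multiplies. -/
def mulAutFactor (p : ℕ) : MulAut (Multiplicative (ZMod p)) →* ZMod p where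
  toFun f := (f (Multiplicative.ofAdd 1)).toAdd
  map_one' := rfl
  map_mul' f g := toAdd_mulAut_apply_eq f (g (Multiplicative.ofAdd 1))

theorem toAdd_mulAut_apply (f : MulAut (Multiplicative (ZMod p))) (x : Multiplicative (ZMod p)) :
    (f x).toAdd = mulAutFactor p f * x.toAdd :=
  toAdd_mulAut_apply_eq f x

end Cyclic

/-- Let `H` be a nonabelian semidirect product of the form `ℤ₇ ⋉ (ℤ₂)³` (with `(ℤ₂)³` normal), and
let `G` be a semidirect product `H ⋉ ℤ_p` (with `ℤ_p` normal), for a prime `p > 5`.  Then every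
connected Cayley graph on `G` has a hamiltonian cycle.

In `N ⋊[φ] K` the factor `N` is the normal one. -/
theorem mainTheorem3 {H G : Type*} [Group H] [Group G] [DecidableEq G]
    (φ : Multiplicative (ZMod 7) →* MulAut (Multiplicative (Fin 3 → ZMod 2)))
    (eH : H ≃* Multiplicative (Fin 3 → ZMod 2) ⋊[φ] Multiplicative (ZMod 7))
    (hH : ∃ x y : H, x * y ≠ y * x)
    (p : ℕ) (hp : p.Prime) (hp5 : 5 < p)
    (ψ : H →* MulAut (Multiplicative (ZMod p)))
    (eG : G ≃* Multiplicative (ZMod p) ⋊[ψ] H)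
    (S : Set G) (hS : (SimpleGraph.mulCayley S).Connected) :
    ∃ (g : G) (C : (SimpleGraph.mulCayley S).Walk g g), C.IsHamiltonianCycle := by
  have hprime := Fact.mk hp
  -- The graph is unchanged by adding inverses, so the connection set may be taken symmetric.
  have hSS : SimpleGraph.mulCayley (S ∪ S⁻¹) = SimpleGraph.mulCayley S := by
    rw [SimpleGraph.mulCayley_union, SimpleGraph.mulCayley_inv, sup_idem]
  rw [← hSS] at hS ⊢
  have hcardK : Nat.card (Multiplicative (Fin 3 → ZMod 2) ⋊[φ] Multiplicative (ZMod 7)) = 56 := by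
    rw [SemidirectProduct.card]
    simp
  have hcardG : Nat.card G = p * 56 := by
    rw [Nat.card_congr eG.toEquiv, SemidirectProduct.card, Nat.card_congr eH.toEquiv, hcardK]
    simp
  have : Finite G := Nat.finite_of_card_ne_zero (by have := hp.pos; omega)
  have := Fintype.ofFinite G
  let q : G →* Multiplicative (Fin 3 → ZMod 2) ⋊[φ] Multiplicative (ZMod 7) :=
    eH.toMonoidHom.comp (SemidirectProduct.rightHom.comp eG.toMonoidHom)
  have hq : ∀ g, q g = eH (eG g).right := fun g => rfl
  have hsurj : Function.Surjective q :=
    eH.surjective.comp (SemidirectProduct.rightHom_surjective.comp eG.surjective)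
  let χ : G →* ZMod p := (mulAutFactor p).comp
    (ψ.comp (SemidirectProduct.rightHom.comp eG.toMonoidHom))
  have hχ : ∀ g, χ g = mulAutFactor p (ψ (eG g).right) := fun g => rfl
  let c : G → ZMod p := fun g => (eG g).left.toAdd
  have hc : IsCrossedHom χ c := by
    intro g h
    simp only [c, map_mul, SemidirectProduct.mul_left, toAdd_mul, toAdd_mulAut_apply, hχ]
  have hinj : ∀ g, q g = 1 → c g = 0 → g = 1 := by
    intro g hg hcg
    apply eG.injective
    rw [map_one]
    ext
    · exact hcg
    · exact (MulEquiv.map_eq_one_iff eH).1 hg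
  have hnc : ∃ x y : Multiplicative (Fin 3 → ZMod 2) ⋊[φ] Multiplicative (ZMod 7),
      x * y ≠ y * x := by
    obtain ⟨x, y, hxy⟩ := hH
    refine ⟨eH x, eH y, fun h => hxy (eH.injective ?_)⟩
    rw [map_mul, map_mul, h]
  have hset : IsCayleySetup q χ (S ∪ S⁻¹) := {
    card_left := by simp
    card_right := by simp
    mul_self := by decide
    noncomm := hnc
    surj := hsurj
    prime := hp
    five_lt := hp5
    card := by rw [← Nat.card_eq_fintype_card, hcardG, mul_comm]
    card_ker := by
      have h := Subgroup.card_mul_index q.ker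
      rw [Subgroup.index_ker, MonoidHom.range_eq_top.2 hsurj, Subgroup.card_top, hcardK,
        hcardG] at h
      exact Nat.eq_of_mul_eq_mul_right (by norm_num) h
    char := by
      intro g hg
      have h := char_inl_eq_one (by simp) (by simp) (by decide) (semidirect_action_ne_one hnc)
        ((mulAutFactor p).comp (ψ.comp eH.symm.toMonoidHom)) (q g).left
      have hgl : SemidirectProduct.inl (q g).left = q g := by
        ext
        · simp
        · rw [hg]; simp
      rw [hgl] at h
      simpa [hq, hχ] using h
    inv_mem := by
      rintro s (hs | hs)
      · exact .inr (by simpa using hs)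
      · exact .inl hs
    gen := closure_eq_top_of_mulCayley_connected hS }
  by_cases hχ1 : ∃ g, χ g ≠ 1
  · refine hset.hasHamiltonianCycle_of_second hc hinj isCrossedHom_char_sub_one fun g => ?_
    rw [sub_eq_zero]
    exact hset.char_eq_one_iff hχ1 g
  push Not at hχ1
  by_cases hp7 : p = 7
  · subst hp7
    -- For trivial `χ`, crossed homomorphisms are homomorphisms to `ZMod p`; as `p = 7`, the
    -- `ℤ₇`-coordinate is one.
    refine hset.hasHamiltonianCycle_of_second hc hinj (κ := fun g => (q g).right.toAdd)
      (fun g h => ?_) fun g => Iff.rfl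
    simp [hχ1]
  · exact hset.hasHamiltonianCycle_of_char_eq_one hc hinj hχ1 hp7
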